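/- For $\tau\in\mathbb H=\{\operatorname{Im}\tau>0\}$ let $\wp(z)=\wp(z\,|\,2,2\tau)$ be the Weierstrass function with half-periods $2$ and $2\tau$ (periods $4$, $4\tau$), and let $$x(\tau)=\frac{\wp(1)-\wp(2)}{\wp(\tau)-\wp(2)},\qquad y(\tau)=4i\,\frac{[\wp(\tau)-\wp(2\tau)]\,[\wp(\frac\tau2)-\wp(\tau)]\,[\wp(\frac\tau2)-\wp(\tau+2)]\,[\wp(\frac12)-\wp(2\tau+1)]\,[\wp(\frac12)-\wp(1)]}{[\wp(\frac\tau2)-\wp(1)]\,[\wp(\frac\tau2)-\wp(2\tau+1)]\,\wp'(\frac12)\,\wp'(\tau)}$$ be Burnside's functions. They are holomorphic on $\mathbb H$, satisfy $y^2=x^5-x$, and have the following canonical Laurent expansions in local parameters at the cusps. Here "canonical" means that all coefficients of each series in parentheses, not only the displayed ones, are integers; each expansion converges to the function for every $\tau\in\mathbb H$, and $q\to0$ as $\tau$ tends vertically to the cusp. (1) At the pole $\tau=2$, with $q=\exp\left(\frac{\pi i}{4}\frac{2\tau-5}{\tau-2}\right)$, there are series in powers of $q^8$ $$x=\tfrac12q^{-2}(1+2q^8-q^{16}-2q^{24}+3q^{32}+2q^{40}-4q^{48}-4q^{56}+\cdots),$$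 $$y=\tfrac{\sqrt2}{8}q^{-5}(1-3q^8-3q^{16}+14q^{24}+6q^{32}-33q^{40}-20q^{48}+\cdots).$$ (2) At the zero $\tau=0$, with $q=\exp\left(\frac{\pi i}{4}\frac{\tau-2}{2\tau}\right)$, there are series in powers of $q^8$ $$x=2e^{\frac34\pi i}q^{2}(1+2q^8+5q^{16}+10q^{24}+18q^{32}+32q^{40}+\cdots),$$ $$y=-e^{-\frac18\pi i}\sqrt2\,q\,(1+9q^8+42q^{16}+147q^{24}+444q^{32}+1206q^{40}+\cdots).$$ (3) At the four cusps over $\varepsilon=\pm1,\pm i$ there is, up to multipliers, one and the same pair of series in powers of $q^2$: $$x=\varepsilon\,(1+4q^2+8q^4+16q^6+32q^8+56q^{10}+96q^{12}+\cdots),$$ $$y=4\sqrt\varepsilon\;q\,(1+6q^2+24q^4+80q^6+231q^8+606q^{10}+\cdots),$$ where, for the cusps $\tau=\frac12,\ i\infty,\ 1,\ -1$ respectively, $\varepsilon=1,\,-1,\,i,\,-i$, $\sqrt\varepsilon$ denotes the square root $1,\,-i,\,e^{\pi i/4},\,e^{-\pi i/4}$ of $\varepsilon$, and $q=\exp\left(\frac{\pi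 i}{4}\,m(\tau)\right)$ with $m(\tau)=\frac{3\tau-2}{2\tau-1},\ \tau-2,\ \frac{\tau-2}{\tau-1},\ -\frac{\tau+2}{\tau+1}$. (4) The functions on $\mathbb H$ (identified when they differ only on a closed discrete set) of the form $F(x(\tau),y(\tau))$, where $F$ is a meromorphic function on the compact Riemann surface of $y^2=x^5-x$, form a field. It is the field $\mathbb C(x,y)$ generated over $\mathbb C$ by $x(\tau)$ and $y(\tau)$, and consists exactly of the functions $R_1(x(\tau))+y(\tau)R_2(x(\tau))$ with rational $R_1,R_2\in\mathbb C(X)$, which are uniquely determined. -/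

import Mathlib

open Filter Topology
open scoped Manifold UpperHalfPlane

noncomputable section

/-- The numbers `4` and `4 τ` are `ℝ`-linearly independent for `τ` in the upper half-plane. -/
theorem burnside_indep (τ : ℍ) : LinearIndependent ℝ ![(4 : ℂ), 4 * (τ : ℂ)] := by
  rw [LinearIndependent.pair_iff]
  intro s t h
  have him := congrArg Complex.im h
  have hre := congrArg Complex.re h
  have hτ : (τ : ℂ).im ≠ 0 := by simpa using τ.im_pos.ne'
  simp at him hre
  have ht : t = 0 := by
    rcases him with h1 | h1
    · exact h1
    · exact absurd h1 (by simpa using hτ)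
  subst ht
  simpa using hre

/-- The pair of periods `(2ω, 2ω') = (4, 4τ)`, that is, half-periods `(ω, ω') = (2, 2τ)`. -/
def burnsidePeriods (τ : ℍ) : PeriodPair where
  ω₁ := 4
  ω₂ := 4 * (τ : ℂ)
  indep := burnside_indep τ

/-- `℘(z | 2, 2τ)`: the Weierstrass function with half-periods `2` and `2τ`. -/
def wp (τ : ℍ) (z : ℂ) : ℂ := (burnsidePeriods τ).weierstrassP z

/-- `℘'(z | 2, 2τ)`, the derivative with respect to `z`. -/
def wpDeriv (τ : ℍ) (z : ℂ) : ℂ := (burnsidePeriods τ).derivWeierstrassP z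

/-- Burnside's function `x(τ)`. -/
def burnsideX (τ : ℍ) : ℂ := (wp τ 1 - wp τ 2) / (wp τ τ - wp τ 2)

/-- Burnside's function `y(τ)`. -/
def burnsideY (τ : ℍ) : ℂ :=
  4 * Complex.I *
    ((wp τ τ - wp τ (2 * τ)) * (wp τ (τ / 2) - wp τ τ) * (wp τ (τ / 2) - wp τ (τ + 2)) *
      (wp τ (1 / 2) - wp τ (2 * τ + 1)) * (wp τ (1 / 2) - wp τ 1)) /
    ((wp τ (τ / 2) - wp τ 1) * (wp τ (τ / 2) - wp τ (2 * τ + 1)) *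
      wpDeriv τ (1 / 2) * wpDeriv τ τ)

/-- The coordinate `q = exp ((π i / 4) (a z + b) / (c z + d))`. -/
def cuspParam (a b c d : ℤ) (z : ℂ) : ℂ :=
  Complex.exp (Real.pi * Complex.I / 4 * ((a * z + b) / (c * z + d)))

/-- `q → 0` as `τ → r + i 0`, where `r` is a real cusp. -/
def VanishesAtReal (q : ℂ → ℂ) (r : ℝ) : Prop :=
  Tendsto (fun t : ℝ => q (r + t * Complex.I)) (𝓝[>] 0) (𝓝 0)

/-- `q → 0` as `τ → + i ∞`. -/
def VanishesAtInfty (q : ℂ → ℂ) : Prop :=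
  Tendsto (fun t : ℝ => q (t * Complex.I)) atTop (𝓝 0)

/-- The Laurent expansion `f = C q ^ m (A 0 + A 1 q ^ k + A 2 q ^ (2 k) + ⋯)` with integer `A n`,
convergent to `f` at every point of the upper half-plane. -/
def HasCuspExpansion (f : ℍ → ℂ) (q : ℂ → ℂ) (C : ℂ) (m : ℤ) (k : ℕ) (A : ℕ → ℤ) : Prop :=
  ∀ τ : ℍ, HasSum (fun n : ℕ => C * q τ ^ m * ((A n : ℂ) * q τ ^ (k * n))) (f τ)

/-- The integer sequence `A` begins with the entries of the list `l`. -/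
def BeginsWith (A : ℕ → ℤ) (l : List ℤ) : Prop := (List.range l.length).map A = l

/-- `F` (only its values at the points of the curve matter) is a meromorphic function on the
compact Riemann surface of `y² = x⁵ - x`: it is meromorphic in each holomorphic local coordinate
`s ↦ (u s, v s)` at each point of the affine curve, and in the coordinate
`s ↦ (s⁻², s⁻⁵ √(1 - s⁸))` at the only point at infinity. -/
def IsMeromorphicOnCurve (F : ℂ × ℂ → ℂ) : Prop :=
  (∀ u v : ℂ → ℂ, AnalyticAt ℂ u 0 → AnalyticAt ℂ v 0 →
      (∀ᶠ s in 𝓝 (0 : ℂ), v s ^ 2 = u s ^ 5 - u s) → (deriv u 0 ≠ 0 ∨ deriv v 0 ≠ 0) →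
      MeromorphicAt (fun s => F (u s, v s)) 0) ∧
    MeromorphicAt (fun s : ℂ => F (s⁻¹ ^ 2, s⁻¹ ^ 5 * (1 - s ^ 8) ^ (1 / 2 : ℂ))) 0

/-- The ring of complex functions on the upper half-plane, two functions being identified when
they differ only on a closed discrete set (such as a set of poles). -/
abbrev FunctionGerms : Type := (codiscrete ℍ).Germ ℂ

/-- The class of `τ ↦ f τ`. -/
def toGerm (f : ℍ → ℂ) : FunctionGerms := (f : (codiscrete ℍ).Germ ℂ)

/-- The function `R₁(x(τ)) + y(τ) R₂(x(τ))`. -/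
def rationalInXY (R₁ R₂ : RatFunc ℂ) (τ : ℍ) : ℂ :=
  R₁.eval (RingHom.id ℂ) (burnsideX τ) + burnsideY τ * R₂.eval (RingHom.id ℂ) (burnsideX τ)

end

/-! Everything rests on product formulas. Let Θ be the theta product `thetaZ`. For fixed b, the
quotient Θ(z - b)Θ(z + b)/Θ(z)² is even and elliptic, with at most double poles, all at lattice
points. By Liouville it is an affine function of ℘, and it vanishes at z = b. This factors ℘(a) -
℘(b) (`wp_sub_wp`) and, on differentiating, ℘' (`wpDeriv_eq`). In Burnside's functions the powers of
Θ'(0) cancel. With k = exp(πiτ/4), t = k², A = ∏(1 - t^(2n+1)) and B = ∏(1 + t^(2n+1)), what remains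
is x = -A²/B² and y = -4k/(A³B⁹). Let C = ∏(1 + t^(2n+2)). The curve equation then amounts to
Jacobi's B⁸ - A⁸ = 16tC⁸ combined with Euler's ABC = 1. Jacobi's identity is itself the trivial
additive relation between the values of ℘ at the three half-periods, rewritten in products.

In Weber functions at τ/2 the formulas read x = -(𝔣₁/𝔣)² and y = -𝔣₂⁴𝔣₁/𝔣⁵. The map w ↦ -1/w
exchanges 𝔣₁ and 𝔣₂ and fixes 𝔣. The map w ↦ w + 1 exchanges 𝔣 and 𝔣₁ and preserves 𝔣₂, up to 48th
roots of unity. A word in these two maps carries each cusp to i∞, where x and y are again monomials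
in Weber functions of the new variable, that is, a power of q times an infinite product. Such a
product is a limit of integer polynomials with stabilizing coefficients, which gives integrality and
makes the displayed coefficients a finite computation.

For the field statement, x is nonconstant, so rational functions of x make sense off a discrete set.
Since x⁵ - x has odd degree, 1 and y are independent over ℂ(x), and dividing the conjugate by the
norm inverts R₁ + yR₂. Conversely, for F meromorphic on the curve, the trace F(u, v) + F(u, -v)
depends on u alone and is meromorphic on the sphere, hence rational. Applied to F and to F/y, this
recovers F = R₁(x) + yR₂(x). -/

noncomputable section

/-! ### Infinite products and theta products -/

/-- The infinite product `∏ (1 - a pⁿ)`. -/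
def poch (a p : ℂ) : ℂ := ∏' n : ℕ, (1 - a * p ^ n)

theorem summable_norm_mul_pow (a : ℂ) {p : ℂ} (hp : ‖p‖ < 1) :
    Summable fun n : ℕ => ‖-(a * p ^ n)‖ := by
  simpa using (summable_geometric_of_lt_one (norm_nonneg p) hp).mul_left ‖a‖

theorem multipliable_poch (a : ℂ) {p : ℂ} (hp : ‖p‖ < 1) :
    Multipliable fun n : ℕ => 1 - a * p ^ n := by
  simpa [sub_eq_add_neg] using multipliable_one_add_of_summable (summable_norm_mul_pow a hp)

theorem poch_eq_mul_poch (a : ℂ) {p : ℂ} (hp : ‖p‖ < 1) :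
    poch a p = (1 - a) * poch (a * p) p := by
  have e : (fun n : ℕ => 1 - a * p ^ (n + 1)) = fun n => 1 - a * p * p ^ n := by
    ext n; ring
  have h := tprod_eq_zero_mul' (f := fun n : ℕ => 1 - a * p ^ n)
    (by rw [e]; exact multipliable_poch (a * p) hp)
  rw [e] at h
  simpa [poch] using h

theorem poch_mul_poch_neg (a : ℂ) {p : ℂ} (hp : ‖p‖ < 1) :
    poch a p * poch (-a) p = poch (a ^ 2) (p ^ 2) := by
  rw [poch, poch, ← (multipliable_poch a hp).tprod_mul (multipliable_poch (-a) hp), poch]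
  congr 1; ext n; ring

theorem norm_pow_lt_one {p : ℂ} (hp : ‖p‖ < 1) {n : ℕ} (hn : n ≠ 0) : ‖p ^ n‖ < 1 := by
  rw [norm_pow]; exact pow_lt_one₀ (norm_nonneg _) hp hn

theorem poch_sq_mul_poch_sq (a : ℂ) {p : ℂ} (hp : ‖p‖ < 1) :
    poch a (p ^ 2) * poch (a * p) (p ^ 2) = poch a p := by
  have hp2 := norm_pow_lt_one hp two_ne_zero
  have e1 : (fun n : ℕ => 1 - a * p ^ (2 * n)) = fun n => 1 - a * (p ^ 2) ^ n := by
    ext n; rw [pow_mul]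
  have e2 : (fun n : ℕ => 1 - a * p ^ (2 * n + 1)) = fun n => 1 - a * p * (p ^ 2) ^ n := by
    ext n; rw [pow_succ, pow_mul]; ring
  have h := tprod_even_mul_odd (f := fun n : ℕ => 1 - a * p ^ n)
    (by rw [e1]; exact multipliable_poch _ hp2) (by rw [e2]; exact multipliable_poch _ hp2)
  rw [e1, e2] at h
  exact h

theorem poch_ne_zero {a p : ℂ} (hp : ‖p‖ < 1) (h : ∀ n : ℕ, a * p ^ n ≠ 1) : poch a p ≠ 0 := by
  have := tprod_one_add_ne_zero_of_summable (f := fun n : ℕ => -(a * p ^ n))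
    (fun n => by rw [← sub_eq_add_neg, sub_ne_zero]; exact (h n).symm) (summable_norm_mul_pow a hp)
  simpa [poch, sub_eq_add_neg] using this

theorem poch_ne_zero_of_norm_lt_one {a p : ℂ} (hp : ‖p‖ < 1) (ha : ‖a‖ < 1) : poch a p ≠ 0 := by
  refine poch_ne_zero hp fun n h => ?_
  have h1 : ‖a * p ^ n‖ < 1 := by
    rw [norm_mul, norm_pow]
    exact mul_lt_one_of_nonneg_of_lt_one_left (norm_nonneg _) ha
      (pow_le_one₀ (norm_nonneg _) hp.le)
  rw [h] at h1
  simp at h1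

theorem differentiable_poch {p : ℂ} (hp : ‖p‖ < 1) : Differentiable ℂ fun a => poch a p := by
  intro a
  have hR : a ∈ Metric.ball (0 : ℂ) (‖a‖ + 1) := by simp
  have h := Summable.hasProdLocallyUniformlyOn_nat_one_add (K := Metric.ball (0 : ℂ) (‖a‖ + 1))
    (f := fun (n : ℕ) (a : ℂ) => -(a * p ^ n)) (u := fun n => (‖a‖ + 1) * ‖p‖ ^ n)
    Metric.isOpen_ball ((summable_geometric_of_lt_one (norm_nonneg p) hp).mul_left _)
    (.of_forall fun n x hx => by
      rw [norm_neg, norm_mul, norm_pow]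
      have : ‖x‖ ≤ ‖a‖ + 1 := (by simpa using hx : ‖x‖ < ‖a‖ + 1).le
      gcongr) (fun n => by fun_prop)
  have hd := h.differentiableOn (.of_forall fun s => by
    simpa [Finset.prod_fn] using DifferentiableOn.finsetProd (fun _ _ => by fun_prop))
    Metric.isOpen_ball
  have := hd.differentiableAt (Metric.isOpen_ball.mem_nhds hR)
  simpa [poch, sub_eq_add_neg] using this

/-- The product `∏ (1 - t^(2n+1))`. -/
def oddProd (t : ℂ) : ℂ := poch t (t ^ 2)

/-- The product `∏ (1 + t^(2n+2))`. -/
def evenProd (t : ℂ) : ℂ := poch (-t ^ 2) (t ^ 2)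

theorem poch_self_ne_zero {t : ℂ} (ht : ‖t‖ < 1) : poch t t ≠ 0 :=
  poch_ne_zero_of_norm_lt_one ht ht

theorem oddProd_mul_poch {t : ℂ} (ht : ‖t‖ < 1) :
    oddProd t * poch (t ^ 2) (t ^ 2) = poch t t := by
  have := poch_sq_mul_poch_sq t ht
  rwa [← pow_two] at this

theorem evenProd_mul_poch {t : ℂ} (ht : ‖t‖ < 1) :
    evenProd t * poch (t ^ 2) (t ^ 2) = poch (t ^ 4) (t ^ 4) := by
  have := poch_mul_poch_neg (t ^ 2) (norm_pow_lt_one ht two_ne_zero)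
  rw [evenProd, mul_comm, this]
  ring_nf

theorem oddProd_ne_zero {t : ℂ} (ht : ‖t‖ < 1) : oddProd t ≠ 0 :=
  poch_ne_zero_of_norm_lt_one (norm_pow_lt_one ht two_ne_zero) ht

theorem evenProd_ne_zero {t : ℂ} (ht : ‖t‖ < 1) : evenProd t ≠ 0 :=
  poch_ne_zero_of_norm_lt_one (norm_pow_lt_one ht two_ne_zero)
    (by rw [norm_neg]; exact norm_pow_lt_one ht two_ne_zero)

theorem evenProd_neg (t : ℂ) : evenProd (-t) = evenProd t := by simp [evenProd]

theorem oddProd_mul_oddProd_neg {t : ℂ} (ht : ‖t‖ < 1) :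
    oddProd t * oddProd (-t) = oddProd (t ^ 2) := by
  have := poch_mul_poch_neg t (norm_pow_lt_one ht two_ne_zero)
  simpa [oddProd] using this

/-- Euler's identity `∏ (1 - t^(2n+1)) (1 + t^(2n+1)) (1 + t^(2n+2)) = 1`. -/
theorem oddProd_mul_oddProd_neg_mul_evenProd {t : ℂ} (ht : ‖t‖ < 1) :
    oddProd t * oddProd (-t) * evenProd t = 1 := by
  have h2 := norm_pow_lt_one ht two_ne_zero
  have e1 := oddProd_mul_poch h2
  have e2 := evenProd_mul_poch ht
  have h4 : (t ^ 2) ^ 2 = t ^ 4 := by ring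
  rw [h4] at e1
  have n1 := poch_self_ne_zero h2
  have n2 := poch_self_ne_zero (norm_pow_lt_one ht four_ne_zero)
  rw [oddProd_mul_oddProd_neg ht]
  apply mul_right_cancel₀ (mul_ne_zero n1 n2)
  linear_combination (evenProd t * poch (t ^ 2) (t ^ 2)) * e1 + poch (t ^ 2) (t ^ 2) * e2

/-- The theta product `∏ (1 - Qⁿ u) (1 - Qⁿ⁺¹ / u)`. -/
def thetaProd (Q u : ℂ) : ℂ := poch u Q * poch (Q / u) Q

theorem thetaProd_div (Q : ℂ) {u : ℂ} (hQ : Q ≠ 0) : thetaProd Q (Q / u) = thetaProd Q u := by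
  by_cases hu : u = 0
  · simp [thetaProd, hu]
  · rw [thetaProd, thetaProd, div_div_cancel₀ hQ, mul_comm]

/-- The shift removes the factor 1 - u from the first product and adds 1 - 1/u to the second; their
ratio (1 - 1/u)/(1 - u) is -1/u. -/
theorem thetaProd_mul {Q u : ℂ} (hQ : ‖Q‖ < 1) (hQ0 : Q ≠ 0) (hu : u ≠ 0) :
    thetaProd Q (Q * u) = -thetaProd Q u / u := by
  rw [thetaProd, thetaProd, poch_eq_mul_poch u hQ, mul_comm u Q,
    show Q / (Q * u) = u⁻¹ by field_simp, poch_eq_mul_poch u⁻¹ hQ,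
    show u⁻¹ * Q = Q / u by field_simp]
  field_simp
  ring

theorem thetaProd_inv {Q u : ℂ} (hQ : ‖Q‖ < 1) (hQ0 : Q ≠ 0) (hu : u ≠ 0) :
    thetaProd Q u⁻¹ = -thetaProd Q u / u := by
  rw [← thetaProd_mul hQ hQ0 hu, ← thetaProd_div Q hQ0]
  simp

theorem thetaProd_mul_thetaProd_neg {Q : ℂ} (u : ℂ) (hQ : ‖Q‖ < 1) :
    thetaProd Q u * thetaProd Q (-u) = thetaProd (Q ^ 2) (u ^ 2) := by
  have h1 := poch_mul_poch_neg u hQ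
  have h2 := poch_mul_poch_neg (Q / u) hQ
  rw [thetaProd, thetaProd, thetaProd, ← h1, ← div_pow, ← h2, div_neg]
  ring

theorem thetaProd_sq_mul_thetaProd_sq {Q : ℂ} (u : ℂ) (hQ : ‖Q‖ < 1) :
    thetaProd (Q ^ 2) u * thetaProd (Q ^ 2) (Q * u) = thetaProd Q u := by
  have h1 := poch_sq_mul_poch_sq u hQ
  have h2 := poch_sq_mul_poch_sq (Q / u) hQ
  have e : Q ^ 2 / (Q * u) = Q / u := by
    rcases eq_or_ne Q 0 with rfl | h
    · simp
    · rw [pow_two, mul_div_mul_left _ _ h]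
  rw [thetaProd, thetaProd, thetaProd, ← h1, ← h2, e, mul_comm Q u,
    show Q / u * Q = Q ^ 2 / u by ring]
  ring

/-- The exponents congruent to 1 and to 3 modulo 4 together exhaust the odd ones. -/
theorem thetaProd_pow_four_self {h : ℂ} (hh : ‖h‖ < 1) (h0 : h ≠ 0) :
    thetaProd (h ^ 4) h = oddProd h := by
  have := poch_sq_mul_poch_sq h (norm_pow_lt_one hh two_ne_zero)
  rw [oddProd, ← this, thetaProd]
  congr 2
  · ring
  · field_simp
  · ring

theorem thetaProd_pow_four_neg {h : ℂ} (hh : ‖h‖ < 1) (h0 : h ≠ 0) :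
    thetaProd (h ^ 4) (-h) = oddProd (-h) := by
  have := thetaProd_pow_four_self (h := -h) (by simpa) (by simpa)
  rwa [Even.neg_pow (by decide)] at this

theorem thetaProd_sq_self {h : ℂ} (h0 : h ≠ 0) :
    thetaProd (h ^ 2) h = oddProd h ^ 2 := by
  rw [thetaProd, oddProd, show h ^ 2 / h = h by field_simp, ← pow_two]

theorem thetaProd_neg_one {Q : ℂ} (hQ : ‖Q‖ < 1) :
    thetaProd Q (-1) = 2 * poch (-Q) Q ^ 2 := by
  rw [thetaProd, poch_eq_mul_poch (-1) hQ, show Q / (-1) = -Q by ring, show -1 * Q = -Q by ring]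
  ring

theorem thetaProd_ne_zero {Q u : ℂ} (hQ : ‖Q‖ < 1) (hQ0 : Q ≠ 0) (hu : ∀ n : ℤ, u ≠ Q ^ n) :
    thetaProd Q u ≠ 0 := by
  refine mul_ne_zero (poch_ne_zero hQ fun n h => ?_) (poch_ne_zero hQ fun n h => ?_)
  · apply hu (-n)
    rw [zpow_neg, zpow_natCast]
    exact eq_inv_of_mul_eq_one_left h
  · apply hu (n + 1)
    rcases eq_or_ne u 0 with rfl | h0
    · simp at h
    · rw [zpow_add₀ hQ0, zpow_natCast, zpow_one]
      field_simp at h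
      rw [← h]; ring

/-! ### Even elliptic functions with double poles -/

theorem AnalyticAt.dslope_self {f : ℂ → ℂ} {a : ℂ} (hf : AnalyticAt ℂ f a) :
    AnalyticAt ℂ (dslope f a) a := by
  obtain ⟨p, hp⟩ := hf
  exact ⟨_, hp.has_fpower_series_dslope_fslope⟩

/-- An even elliptic function whose only poles are at most double and at the lattice points is an
affine function of `℘`. -/
theorem PeriodPair.eq_mul_weierstrassP_add_const (L : PeriodPair) {f K : ℂ → ℂ}
    (hper : ∀ z, ∀ l ∈ L.lattice, f (z + l) = f z) (heven : ∀ z, f (-z) = f z)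
    (hK : AnalyticAt ℂ K 0) (hf : ∀ᶠ z in 𝓝[≠] 0, f z = K z / z ^ 2)
    (hd : ∀ z ∉ L.lattice, AnalyticAt ℂ f z) :
    ∃ c, ∀ z ∉ L.lattice, f z = K 0 * L.weierstrassP z + c := by
  classical
  have hneg : Tendsto (fun z : ℂ => -z) (𝓝[≠] 0) (𝓝[≠] 0) := by
    have : Tendsto (fun z : ℂ => -z) (𝓝 0) (𝓝 0) := by
      simpa using (continuous_neg (G := ℂ)).tendsto 0
    exact tendsto_nhdsWithin_iff.2 ⟨this.mono_left nhdsWithin_le_nhds,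
      by filter_upwards [self_mem_nhdsWithin] with z hz; simpa using hz⟩
  have hKe : ∀ᶠ z in 𝓝 (0 : ℂ), K (-z) = K z := by
    rw [← nhdsNE_sup_pure, eventually_sup]
    refine ⟨?_, by simp⟩
    filter_upwards [hf, hneg.eventually hf, self_mem_nhdsWithin] with z h1 h2 hz
    have hz : z ≠ 0 := hz
    rw [heven, h1] at h2
    field_simp at h2
    exact h2.symm
  -- Evenness of `f` makes `K` even, which excludes a simple-pole term; hence `K z = K 0 + z ^ 2 * M
  -- z`.
  have hK' : deriv K 0 = 0 := by
    have h := EventuallyEq.deriv_eq hKe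
    rw [deriv_comp_neg] at h
    simpa [neg_eq_iff_add_eq_zero, ← two_mul] using h
  set M := dslope (dslope K 0) 0 with hM
  have hMa : AnalyticAt ℂ M 0 := hK.dslope_self.dslope_self
  have hKM : ∀ z, K z = K 0 + z ^ 2 * M z := by
    intro z
    have h1 := sub_smul_dslope K 0 z
    have h2 := sub_smul_dslope (dslope K 0) 0 z
    rw [dslope_same, hK'] at h2
    simp only [sub_zero, smul_eq_mul] at h1 h2
    rw [← hM] at h2
    linear_combination -h1 - z * h2
  -- The difference of `f` and `K 0 * ℘`, with its removable singularities filled in. The value is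
  -- `M 0` because ℘(z) - 1/z² vanishes at the origin.
  set G : ℂ → ℂ := fun z => if z ∈ L.lattice then M 0 else f z - K 0 * L.weierstrassP z with hG
  have hG0 : AnalyticAt ℂ G 0 := by
    have : AnalyticAt ℂ (fun z => M z - K 0 * L.weierstrassPExcept 0 z) 0 := by
      have := L.analyticAt_weierstrassPExcept 0
      fun_prop
    refine this.congr ?_
    rw [EventuallyEq, ← nhdsNE_sup_pure, eventually_sup]
    refine ⟨?_, by simp [hG]⟩
    filter_upwards [hf, mem_nhdsWithin_of_mem_nhds (L.compl_lattice_sdiff_singleton_mem_nhds 0),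
      self_mem_nhdsWithin] with z h1 h2 h3
    have h3 : z ≠ 0 := h3
    have h4 : z ∉ L.lattice := fun h => h2 ⟨h, h3⟩
    have h5 := L.weierstrassPExcept_def 0 z
    simp only [ZeroMemClass.coe_zero] at h5
    rw [hG]
    simp only [h4, if_false]
    rw [h1, hKM z, h5]
    field_simp
    ring
  have hGp : ∀ z, ∀ l ∈ L.lattice, G (z + l) = G z := by
    intro z l hl
    have e1 : z + l ∈ L.lattice ↔ z ∈ L.lattice :=
      L.lattice.toAddSubgroup.add_mem_cancel_right (y := z) hl
    have e2 := L.weierstrassP_add_coe z ⟨l, hl⟩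
    simp only [hG, e1, hper z l hl]
    simp only at e2
    rw [e2]
  have hGa : ∀ z, AnalyticAt ℂ G z := by
    intro z
    by_cases hz : z ∈ L.lattice
    · rw [← sub_self z] at hG0
      have := hG0.comp (f := (· - z)) (by fun_prop)
      convert! this using 1
      ext w
      simpa using (hGp (w - z) z hz)
    · have h1 : AnalyticAt ℂ (fun z => f z - K 0 * L.weierstrassP z) z := by
        have := L.analyticOnNhd_weierstrassP z hz
        have := hd z hz
        fun_prop
      refine h1.congr ?_
      filter_upwards [L.isClosed_lattice.isOpen_compl.mem_nhds hz] with w hw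
      have hw : w ∉ L.lattice := hw
      simp [hG, hw]
  have hGd : Differentiable ℂ G := fun z => (hGa z).differentiableAt
  refine ⟨M 0, fun z hz => ?_⟩
  -- Liouville: a continuous doubly periodic function has compact range.
  have := hGd.apply_eq_apply_of_bounded
    (IsZLattice.isCompact_range_of_periodic L.lattice _ hGd.continuous hGp).isBounded z 0
  simp only [hG, hz, if_false, zero_mem, if_true] at this
  linear_combination this

/-! ### Theta factorization of differences of ℘ and of ℘' -/

/-- The nome `exp (2 π i τ)`. -/
def nomeQ (τ : ℍ) : ℂ := Complex.exp (2 * Real.pi * Complex.I * τ)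

/-- The character `z ↦ exp (π i z / 2)` of period `4`. -/
def expQuarter (z : ℂ) : ℂ := Complex.exp (Real.pi * Complex.I / 2 * z)

theorem expQuarter_ne_zero (z : ℂ) : expQuarter z ≠ 0 := Complex.exp_ne_zero _

theorem expQuarter_add (z w : ℂ) : expQuarter (z + w) = expQuarter z * expQuarter w := by
  rw [expQuarter, mul_add, Complex.exp_add]; rfl

theorem expQuarter_neg (z : ℂ) : expQuarter (-z) = (expQuarter z)⁻¹ := by
  rw [expQuarter, mul_neg, Complex.exp_neg]; rfl

theorem expQuarter_sub (z w : ℂ) : expQuarter (z - w) = expQuarter z / expQuarter w := by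
  rw [sub_eq_add_neg, expQuarter_add, expQuarter_neg, div_eq_mul_inv]

theorem expQuarter_zero : expQuarter 0 = 1 := by simp [expQuarter]

theorem expQuarter_four : expQuarter 4 = 1 := by
  rw [expQuarter, ← Complex.exp_two_pi_mul_I]; congr 1; ring

theorem expQuarter_four_mul (τ : ℍ) : expQuarter (4 * τ) = nomeQ τ := by
  rw [expQuarter, nomeQ]; congr 1; ring

theorem norm_nomeQ_lt_one (τ : ℍ) : ‖nomeQ τ‖ < 1 := UpperHalfPlane.norm_exp_two_pi_I_lt_one τ

theorem nomeQ_ne_zero (τ : ℍ) : nomeQ τ ≠ 0 := Complex.exp_ne_zero _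

/-- The theta product in the variable `z`. -/
def thetaZ (τ : ℍ) (z : ℂ) : ℂ := thetaProd (nomeQ τ) (expQuarter z)

theorem mem_burnside_lattice {τ : ℍ} {z : ℂ} :
    z ∈ (burnsidePeriods τ).lattice ↔ ∃ m n : ℤ, (m : ℂ) * 4 + n * (4 * τ) = z :=
  PeriodPair.mem_lattice

theorem expQuarter_ne_zpow {τ : ℍ} {z : ℂ} (hz : z ∉ (burnsidePeriods τ).lattice) (n : ℤ) :
    expQuarter z ≠ nomeQ τ ^ n := by
  intro h
  apply hz
  rw [nomeQ, ← Complex.exp_int_mul, expQuarter, Complex.exp_eq_exp_iff_exists_int] at h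
  obtain ⟨m, hm⟩ := h
  refine mem_burnside_lattice.2 ⟨m, n, ?_⟩
  have hpi : (Real.pi * Complex.I : ℂ) ≠ 0 := by simp [Real.pi_ne_zero]
  apply mul_left_cancel₀ hpi
  linear_combination -2 * hm

theorem thetaZ_ne_zero {τ : ℍ} {z : ℂ} (hz : z ∉ (burnsidePeriods τ).lattice) :
    thetaZ τ z ≠ 0 :=
  thetaProd_ne_zero (norm_nomeQ_lt_one τ) (nomeQ_ne_zero τ) (expQuarter_ne_zpow hz)

theorem thetaZ_add_four (τ : ℍ) (z : ℂ) : thetaZ τ (z + 4) = thetaZ τ z := by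
  rw [thetaZ, expQuarter_add, expQuarter_four, mul_one, thetaZ]

theorem thetaZ_add_four_mul (τ : ℍ) (z : ℂ) :
    thetaZ τ (z + 4 * τ) = -thetaZ τ z / expQuarter z := by
  rw [thetaZ, expQuarter_add, expQuarter_four_mul, mul_comm,
    thetaProd_mul (norm_nomeQ_lt_one τ) (nomeQ_ne_zero τ) (expQuarter_ne_zero z), thetaZ]

theorem thetaZ_neg (τ : ℍ) (z : ℂ) : thetaZ τ (-z) = -thetaZ τ z / expQuarter z := by
  rw [thetaZ, expQuarter_neg,
    thetaProd_inv (norm_nomeQ_lt_one τ) (nomeQ_ne_zero τ) (expQuarter_ne_zero z), thetaZ]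

theorem differentiable_expQuarter : Differentiable ℂ expQuarter := by
  unfold expQuarter; fun_prop

theorem differentiable_thetaZ (τ : ℍ) : Differentiable ℂ (thetaZ τ) := by
  have h := differentiable_poch (norm_nomeQ_lt_one τ)
  have h1 := h.comp differentiable_expQuarter
  have h2 := h.comp ((differentiable_const (nomeQ τ)).div differentiable_expQuarter
    expQuarter_ne_zero)
  exact h1.mul h2

theorem thetaZ_zero (τ : ℍ) : thetaZ τ 0 = 0 := by
  rw [thetaZ, expQuarter_zero, thetaProd, poch_eq_mul_poch 1 (norm_nomeQ_lt_one τ)]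
  simp

/-- The derivative at the origin of the theta product. -/
def thetaZDeriv (τ : ℍ) : ℂ := deriv (thetaZ τ) 0

theorem hasDerivAt_thetaZ_zero (τ : ℍ) : HasDerivAt (thetaZ τ) (thetaZDeriv τ) 0 :=
  (differentiable_thetaZ τ 0).hasDerivAt

/-- The zero at the origin is simple: it comes only from the factor 1 - `expQuarter z`, and the
remaining product there is the square of `poch (nomeQ τ) (nomeQ τ)`. -/
theorem thetaZDeriv_ne_zero (τ : ℍ) : thetaZDeriv τ ≠ 0 := by
  have hQ := norm_nomeQ_lt_one τ
  have h := differentiable_poch hQ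
  have h1 : HasDerivAt (fun z => 1 - expQuarter z) (-(Real.pi * Complex.I / 2)) 0 := by
    have : HasDerivAt (fun z : ℂ => Real.pi * Complex.I / 2 * z) (Real.pi * Complex.I / 2) 0 := by
      simpa using (hasDerivAt_id (0 : ℂ)).const_mul (Real.pi * Complex.I / 2 : ℂ)
    simpa [expQuarter] using (this.cexp).const_sub 1
  have h2 : Differentiable ℂ (fun z => poch (expQuarter z * nomeQ τ) (nomeQ τ) *
      poch (nomeQ τ / expQuarter z) (nomeQ τ)) :=
    (h.comp (differentiable_expQuarter.mul_const (nomeQ τ))).mul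
      (h.comp ((differentiable_const (nomeQ τ)).div differentiable_expQuarter expQuarter_ne_zero))
  have h3 := h1.mul (h2 0).hasDerivAt
  have e : thetaZ τ = (fun z => 1 - expQuarter z) * (fun z =>
      poch (expQuarter z * nomeQ τ) (nomeQ τ) * poch (nomeQ τ / expQuarter z) (nomeQ τ)) := by
    ext z
    rw [thetaZ, thetaProd, poch_eq_mul_poch (expQuarter z) hQ]
    simp [mul_assoc]
  rw [thetaZDeriv, e, h3.deriv]
  simp [expQuarter_zero, Real.pi_ne_zero, poch_self_ne_zero hQ]

/-- The quotient `Θ(z - b) Θ(z + b) / Θ(z)²`. -/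
def thetaQuot (τ : ℍ) (b z : ℂ) : ℂ := thetaZ τ (z - b) * thetaZ τ (z + b) / thetaZ τ z ^ 2

theorem thetaQuot_add_four (τ : ℍ) (b : ℂ) : Function.Periodic (thetaQuot τ b) 4 := fun z => by
  rw [thetaQuot, thetaQuot, thetaZ_add_four, show z + 4 - b = z - b + 4 by ring,
    show z + 4 + b = z + b + 4 by ring, thetaZ_add_four, thetaZ_add_four]

/-- The multipliers cancel because `expQuarter (z - b) * expQuarter (z + b) = expQuarter z ^ 2`. -/
theorem thetaQuot_add_four_mul (τ : ℍ) (b : ℂ) :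
    Function.Periodic (thetaQuot τ b) (4 * τ) := fun z => by
  rw [thetaQuot, thetaQuot, thetaZ_add_four_mul, show z + 4 * τ - b = z - b + 4 * τ by ring,
    show z + 4 * τ + b = z + b + 4 * τ by ring, thetaZ_add_four_mul, thetaZ_add_four_mul,
    expQuarter_sub, expQuarter_add]
  have h1 := expQuarter_ne_zero z
  have h2 := expQuarter_ne_zero b
  field_simp

theorem thetaQuot_neg (τ : ℍ) (b z : ℂ) : thetaQuot τ b (-z) = thetaQuot τ b z := by
  rw [thetaQuot, thetaQuot, show -z - b = -(z + b) by ring, show -z + b = -(z - b) by ring,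
    thetaZ_neg, thetaZ_neg, thetaZ_neg, expQuarter_sub, expQuarter_add]
  have h1 := expQuarter_ne_zero z
  have h2 := expQuarter_ne_zero b
  field_simp

/-- The quotient satisfies the hypotheses of `PeriodPair.eq_mul_weierstrassP_add_const`. Its leading
coefficient is Θ(-b)Θ(b)/Θ'(0)², and the additive constant is determined by the zero at z = b. -/
theorem thetaQuot_eq {τ : ℍ} {b z : ℂ} (hb : b ∉ (burnsidePeriods τ).lattice)
    (hz : z ∉ (burnsidePeriods τ).lattice) :
    thetaQuot τ b z =
      -(thetaZ τ b ^ 2 / (expQuarter b * thetaZDeriv τ ^ 2)) * (wp τ z - wp τ b) := by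
  have hT := differentiable_thetaZ τ
  set T := dslope (thetaZ τ) 0 with hTd
  have hTa : AnalyticAt ℂ T 0 := (hT.analyticAt 0).dslope_self
  have hT0 : T 0 = thetaZDeriv τ := by rw [hTd, dslope_same]; rfl
  have hTz : ∀ z, thetaZ τ z = z * T z := by
    intro z
    have := sub_smul_dslope (thetaZ τ) 0 z
    rw [thetaZ_zero] at this
    simpa using this.symm
  set K : ℂ → ℂ := fun z => thetaZ τ (z - b) * thetaZ τ (z + b) / T z ^ 2 with hK
  have hD := thetaZDeriv_ne_zero τ
  have hKa : AnalyticAt ℂ K 0 := by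
    have h1 : AnalyticAt ℂ (fun z => thetaZ τ (z - b)) 0 :=
      (hT.comp (differentiable_id.sub_const b)).analyticAt 0
    have h2 : AnalyticAt ℂ (fun z => thetaZ τ (z + b)) 0 :=
      (hT.comp (differentiable_id.add_const b)).analyticAt 0
    exact (h1.mul h2).div (hTa.pow 2) (by simpa [hT0] using hD)
  obtain ⟨c, hc⟩ := (burnsidePeriods τ).eq_mul_weierstrassP_add_const (f := thetaQuot τ b) (K := K)
    (fun z l hl => by
      obtain ⟨m, n, rfl⟩ := mem_burnside_lattice.1 hl
      exact (((thetaQuot_add_four τ b).int_mul m).add_period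
        ((thetaQuot_add_four_mul τ b).int_mul n)) z)
    (thetaQuot_neg τ b) hKa (by
      filter_upwards with z
      rw [thetaQuot, hTz z, hK, mul_pow, mul_comm, div_div, mul_comm (thetaZ τ _)]
      ring)
    (fun z hz => by
      have h1 : AnalyticAt ℂ (fun z => thetaZ τ (z - b)) z :=
        (hT.comp (differentiable_id.sub_const b)).analyticAt z
      have h2 : AnalyticAt ℂ (fun z => thetaZ τ (z + b)) z :=
        (hT.comp (differentiable_id.add_const b)).analyticAt z
      exact (h1.mul h2).div ((hT.analyticAt z).pow 2) (pow_ne_zero 2 (thetaZ_ne_zero hz)))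
  have h1 := hc z hz
  have h2 := hc b hb
  have h3 : thetaQuot τ b b = 0 := by rw [thetaQuot, sub_self, thetaZ_zero]; simp
  have h4 : K 0 = -(thetaZ τ b ^ 2 / (expQuarter b * thetaZDeriv τ ^ 2)) := by
    simp only [hK, hT0, zero_sub, zero_add, thetaZ_neg]
    have := expQuarter_ne_zero b
    field_simp
  rw [h3] at h2
  rw [h1, ← h4, wp, wp]
  linear_combination -h2

/-- The product formula for differences of values of `℘`. -/
theorem wp_sub_wp {τ : ℍ} {a b : ℂ} (ha : a ∉ (burnsidePeriods τ).lattice)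
    (hb : b ∉ (burnsidePeriods τ).lattice) :
    wp τ a - wp τ b = -(expQuarter b * thetaZDeriv τ ^ 2 * (thetaZ τ (a - b) * thetaZ τ (a + b)) /
      (thetaZ τ a ^ 2 * thetaZ τ b ^ 2)) := by
  have h := thetaQuot_eq hb ha
  have h1 := thetaZ_ne_zero ha
  have h2 := thetaZ_ne_zero hb
  have h3 := thetaZDeriv_ne_zero τ
  have h4 := expQuarter_ne_zero b
  rw [thetaQuot] at h
  field_simp at h ⊢
  linear_combination h

/-- The product formula for `℘'`. -/
theorem wpDeriv_eq {τ : ℍ} {a : ℂ} (ha : a ∉ (burnsidePeriods τ).lattice) :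
    wpDeriv τ a = -(expQuarter a * thetaZDeriv τ ^ 3 * thetaZ τ (2 * a) / thetaZ τ a ^ 4) := by
  have hT := differentiable_thetaZ τ
  have h1 : HasDerivAt (wp τ) (wpDeriv τ a) a := by
    have h := ((burnsidePeriods τ).analyticOnNhd_weierstrassP a ha).differentiableAt.hasDerivAt
    rwa [PeriodPair.deriv_weierstrassP] at h
  set g : ℂ → ℂ := fun z => -(expQuarter a * thetaZDeriv τ ^ 2 * thetaZ τ (z + a) /
      (thetaZ τ z ^ 2 * thetaZ τ a ^ 2)) with hg
  have hga : DifferentiableAt ℂ g a := by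
    have h2 : DifferentiableAt ℂ (fun z => thetaZ τ (z + a)) a :=
      (hT.comp (differentiable_id.add_const a)) a
    exact ((h2.const_mul _).div (((hT a).pow 2).mul_const _)
      (mul_ne_zero (pow_ne_zero 2 (thetaZ_ne_zero ha)) (pow_ne_zero 2 (thetaZ_ne_zero ha)))).neg
  have h2 : HasDerivAt (fun z => thetaZ τ (z - a)) (thetaZDeriv τ) a := by
    have h := hasDerivAt_thetaZ_zero τ
    rw [← sub_self a] at h
    exact h.comp_sub_const a a
  have h3 := (h2.mul hga.hasDerivAt).add_const (wp τ a)
  -- Near `a` the difference ℘(z) - ℘(a) is Θ(z - a) `g z`. As Θ(0) = 0, the term with `deriv g a`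
  -- drops out below.
  have h4 : HasDerivAt (wp τ)
      (thetaZDeriv τ * g a + thetaZ τ (a - a) * deriv g a) a := by
    refine h3.congr_of_eventuallyEq ?_
    filter_upwards [(burnsidePeriods τ).isClosed_lattice.isOpen_compl.mem_nhds ha] with z hz
    have := wp_sub_wp hz ha
    simp only [Pi.mul_apply, hg]
    linear_combination this
  rw [h1.unique h4, sub_self, thetaZ_zero, hg, two_mul]
  simp only [zero_mul, add_zero]
  have := thetaZ_ne_zero ha
  field_simp

/-! ### Product formulas for x and y -/

theorem notMem_burnside_lattice {τ : ℍ} (a b : ℝ) {z : ℂ} (hz : z = a + b * τ)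
    (h : (∀ m : ℤ, a ≠ 4 * m) ∨ ∀ n : ℤ, b ≠ 4 * n) : z ∉ (burnsidePeriods τ).lattice := by
  intro hmem
  obtain ⟨m, n, hmn⟩ := mem_burnside_lattice.1 hmem
  rw [hz] at hmn
  have hlin := LinearIndependent.pair_iff.1 (burnside_indep τ) (m - a / 4) (n - b / 4) (by
    simp only [Complex.real_smul]; push_cast; linear_combination hmn)
  rcases h with h | h
  · exact h m (by linarith [hlin.1])
  · exact h n (by linarith [hlin.2])

/-- Reduces non-membership for a rational coordinate `p / q` to a divisibility that `decide`
settles. -/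
theorem ne_four_mul_intCast {a : ℝ} (p q : ℤ) (ha : a * q = p) (h : ¬ 4 * q ∣ p)
    (m : ℤ) : a ≠ 4 * m := by
  rintro rfl
  apply h
  refine ⟨m, ?_⟩
  have : ((4 * q * m : ℤ) : ℝ) = p := by push_cast; linarith
  exact_mod_cast this.symm

/-- Pairing opposite signs gives theta products of nome u¹⁶ at u² and u⁶. Reflection replaces u⁶ by
u¹⁰ = u⁸u², and the two then merge into one product of nome u⁸ at u². -/
theorem thetaProd_mul_four {u : ℂ} (hu : ‖u‖ < 1) (h0 : u ≠ 0) :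
    thetaProd (u ^ 8) u * thetaProd (u ^ 8) (-u) *
      (thetaProd (u ^ 8) (u ^ 3) * thetaProd (u ^ 8) (-u ^ 3)) = oddProd (u ^ 2) := by
  have h8 := norm_pow_lt_one hu (n := 8) (by norm_num)
  have h2 := norm_pow_lt_one hu (n := 2) (by norm_num)
  rw [thetaProd_mul_thetaProd_neg _ h8, thetaProd_mul_thetaProd_neg _ h8,
    ← thetaProd_pow_four_self h2 (pow_ne_zero 2 h0), show (u ^ 2) ^ 4 = u ^ 8 by ring,
    ← thetaProd_sq_mul_thetaProd_sq _ h8,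
    ← thetaProd_div (u := (u ^ 3) ^ 2) _ (pow_ne_zero 2 (pow_ne_zero 8 h0)),
    show (u ^ 8) ^ 2 / (u ^ 3) ^ 2 = u ^ 8 * u ^ 2 by field_simp]

/-- A primitive eighth root of unity. -/
def zeta8 : ℂ := expQuarter (1 / 2)

theorem zeta8_ne_zero : zeta8 ≠ 0 := expQuarter_ne_zero _

theorem zeta8_sq : zeta8 ^ 2 = Complex.I := by
  rw [zeta8, expQuarter, ← Complex.exp_nat_mul, show ((2 : ℕ) : ℂ) * (Real.pi * Complex.I / 2 *
    (1 / 2)) = Real.pi / 2 * Complex.I by push_cast; ring, Complex.exp_pi_div_two_mul_I]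

theorem zeta8_pow_four : zeta8 ^ 4 = -1 := by
  rw [show zeta8 ^ 4 = (zeta8 ^ 2) ^ 2 by ring, zeta8_sq, Complex.I_sq]

theorem expQuarter_one : expQuarter 1 = zeta8 ^ 2 := by
  rw [show (1 : ℂ) = 1 / 2 + 1 / 2 by norm_num, expQuarter_add, ← zeta8, pow_two]

theorem expQuarter_two : expQuarter 2 = -1 := by
  rw [show (2 : ℂ) = 1 + 1 by norm_num, expQuarter_add, expQuarter_one, ← zeta8_pow_four]
  ring

/-- The function `exp (π i τ / 4)`. -/
def nomeK (τ : ℍ) : ℂ := expQuarter (τ / 2)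

theorem nomeK_ne_zero (τ : ℍ) : nomeK τ ≠ 0 := expQuarter_ne_zero _

theorem expQuarter_self (τ : ℍ) : expQuarter τ = nomeK τ ^ 2 := by
  rw [nomeK, pow_two, ← expQuarter_add]; congr 1; ring

theorem expQuarter_two_mul (τ : ℍ) : expQuarter (2 * τ) = nomeK τ ^ 4 := by
  rw [two_mul, expQuarter_add, expQuarter_self]; ring

theorem nomeQ_eq (τ : ℍ) : nomeQ τ = nomeK τ ^ 8 := by
  rw [← expQuarter_four_mul, show (4 * τ : ℂ) = 2 * τ + 2 * τ by ring, expQuarter_add,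
    expQuarter_two_mul]; ring

theorem norm_nomeK_lt_one (τ : ℍ) : ‖nomeK τ‖ < 1 := by
  have := norm_nomeQ_lt_one τ
  rw [nomeQ_eq, norm_pow] at this
  exact lt_of_pow_lt_pow_left₀ 8 zero_le_one (by simpa using this)

section

variable (τ : ℍ)

theorem notMem_half : (1 / 2 : ℂ) ∉ (burnsidePeriods τ).lattice :=
  notMem_burnside_lattice (1 / 2) 0 (by push_cast; ring)
    (.inl (ne_four_mul_intCast 1 2 (by norm_num) (by decide)))

theorem notMem_one : (1 : ℂ) ∉ (burnsidePeriods τ).lattice :=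
  notMem_burnside_lattice 1 0 (by push_cast; ring)
    (.inl (ne_four_mul_intCast 1 1 (by norm_num) (by decide)))

theorem notMem_two : (2 : ℂ) ∉ (burnsidePeriods τ).lattice :=
  notMem_burnside_lattice 2 0 (by push_cast; ring)
    (.inl (ne_four_mul_intCast 2 1 (by norm_num) (by decide)))

theorem notMem_half_mul : (τ / 2 : ℂ) ∉ (burnsidePeriods τ).lattice :=
  notMem_burnside_lattice 0 (1 / 2) (by push_cast; ring)
    (.inr (ne_four_mul_intCast 1 2 (by norm_num) (by decide)))

theorem notMem_self : (τ : ℂ) ∉ (burnsidePeriods τ).lattice :=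
  notMem_burnside_lattice 0 1 (by push_cast; ring)
    (.inr (ne_four_mul_intCast 1 1 (by norm_num) (by decide)))

theorem notMem_two_mul : (2 * τ : ℂ) ∉ (burnsidePeriods τ).lattice :=
  notMem_burnside_lattice 0 2 (by push_cast; ring)
    (.inr (ne_four_mul_intCast 2 1 (by norm_num) (by decide)))

theorem notMem_add_two : (τ + 2 : ℂ) ∉ (burnsidePeriods τ).lattice :=
  notMem_burnside_lattice 2 1 (by push_cast; ring)
    (.inr (ne_four_mul_intCast 1 1 (by norm_num) (by decide)))

theorem notMem_two_mul_add_one : (2 * τ + 1 : ℂ) ∉ (burnsidePeriods τ).lattice :=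
  notMem_burnside_lattice 1 2 (by push_cast; ring)
    (.inr (ne_four_mul_intCast 2 1 (by norm_num) (by decide)))

theorem notMem_two_mul_add_two : (2 * τ + 2 : ℂ) ∉ (burnsidePeriods τ).lattice :=
  notMem_burnside_lattice 2 2 (by push_cast; ring)
    (.inr (ne_four_mul_intCast 2 1 (by norm_num) (by decide)))

end

theorem thetaZ_self (τ : ℍ) : thetaZ τ τ = oddProd (nomeK τ ^ 2) := by
  have hk := norm_pow_lt_one (norm_nomeK_lt_one τ) two_ne_zero
  have h0 := pow_ne_zero 2 (nomeK_ne_zero τ)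
  rw [thetaZ, nomeQ_eq, expQuarter_self, ← thetaProd_pow_four_self hk h0]
  ring_nf

theorem thetaZ_add_two (τ : ℍ) : thetaZ τ (τ + 2) = oddProd (-nomeK τ ^ 2) := by
  have hk := norm_pow_lt_one (norm_nomeK_lt_one τ) two_ne_zero
  have h0 := pow_ne_zero 2 (nomeK_ne_zero τ)
  rw [thetaZ, nomeQ_eq, expQuarter_add, expQuarter_two, expQuarter_self,
    ← thetaProd_pow_four_neg hk h0]
  ring_nf

/-- After factorization, Θ'(0), Θ(2) and Θ(1) all cancel, since 1 - 2 and 1 + 2 are both -1 modulo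
4; only Θ(τ) and Θ(τ + 2) survive. -/
theorem burnsideX_eq (τ : ℍ) :
    burnsideX τ = -(oddProd (nomeK τ ^ 2) / oddProd (-nomeK τ ^ 2)) ^ 2 := by
  have hD := thetaZDeriv_ne_zero τ
  have n1 := thetaZ_ne_zero (notMem_one τ)
  have n2 := thetaZ_ne_zero (notMem_two τ)
  have n3 := thetaZ_ne_zero (notMem_self τ)
  have n4 := thetaZ_ne_zero (notMem_add_two τ)
  have e1 : thetaZ τ (1 - 2) = -thetaZ τ 1 / zeta8 ^ 2 := by
    rw [show (1 - 2 : ℂ) = -1 by norm_num, thetaZ_neg, expQuarter_one]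
  have e2 : thetaZ τ (1 + 2) = -thetaZ τ 1 / zeta8 ^ 2 := by
    rw [show (1 + 2 : ℂ) = -1 + 4 by norm_num, thetaZ_add_four, thetaZ_neg, expQuarter_one]
  have e3 : thetaZ τ (τ - 2) = thetaZ τ (τ + 2) := by
    rw [← thetaZ_add_four]; congr 1; ring
  rw [burnsideX, wp_sub_wp (notMem_one τ) (notMem_two τ), wp_sub_wp (notMem_self τ) (notMem_two τ),
    e1, e2, e3, expQuarter_two, ← thetaZ_self, ← thetaZ_add_two]
  have h8 := zeta8_ne_zero
  field_simp
  rw [zeta8_pow_four]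
  ring

theorem thetaZ_two_mul (τ : ℍ) :
    thetaZ τ (2 * τ) = (oddProd (nomeK τ ^ 2) * oddProd (-nomeK τ ^ 2)) ^ 2 := by
  have hk := norm_nomeK_lt_one τ
  rw [oddProd_mul_oddProd_neg (norm_pow_lt_one hk two_ne_zero), thetaZ, nomeQ_eq,
    expQuarter_two_mul, ← pow_mul,
    ← thetaProd_sq_self (pow_ne_zero 4 (nomeK_ne_zero τ))]
  ring_nf

/-- Θ'(0) occurs to the power ten in both numerator and denominator. The theta values at the finer
division points come in three groups of four, each of which collapses to a single value (`p1`, `p2`,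
`p3`). -/
theorem burnsideY_eq (τ : ℍ) :
    burnsideY τ =
      -4 * nomeK τ / (oddProd (nomeK τ ^ 2) ^ 3 * oddProd (-nomeK τ ^ 2) ^ 9) := by
  have hD := thetaZDeriv_ne_zero τ
  have h8 := zeta8_ne_zero
  have hk := norm_nomeK_lt_one τ
  have k0 := nomeK_ne_zero τ
  have hQ := norm_nomeQ_lt_one τ
  have Q0 := nomeQ_ne_zero τ
  have n1 := thetaZ_ne_zero (notMem_one τ)
  have n2 := thetaZ_ne_zero (notMem_half τ)
  have n3 := thetaZ_ne_zero (notMem_self τ)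
  have n4 := thetaZ_ne_zero (notMem_add_two τ)
  have n5 := thetaZ_ne_zero (notMem_half_mul τ)
  have n6 := thetaZ_ne_zero (notMem_two_mul τ)
  have n7 := thetaZ_ne_zero (notMem_two_mul_add_one τ)
  have c0 : expQuarter (1 / 2) = zeta8 := rfl
  have c1 : expQuarter (τ / 2) = nomeK τ := rfl
  have c2 : expQuarter (τ + 2) = -nomeK τ ^ 2 := by
    rw [expQuarter_add, expQuarter_two, expQuarter_self]; ring
  have c3 : expQuarter (2 * τ + 1) = zeta8 ^ 2 * nomeK τ ^ 4 := by
    rw [expQuarter_add, expQuarter_one, expQuarter_two_mul]; ring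
  have a1 : thetaZ τ (τ - 2 * τ) = -thetaZ τ τ / nomeK τ ^ 2 := by
    rw [show (τ - 2 * τ : ℂ) = -τ by ring, thetaZ_neg, expQuarter_self]
  have a2 : thetaZ τ (τ + 2 * τ) = thetaZ τ τ := by
    rw [show (τ + 2 * τ : ℂ) = -τ + 4 * τ by ring, thetaZ_add_four_mul, thetaZ_neg,
      expQuarter_neg]
    have := expQuarter_ne_zero τ
    field_simp
  have a3 : thetaZ τ (τ / 2 - τ) = -thetaZ τ (τ / 2) / nomeK τ := by
    rw [show (τ / 2 - τ : ℂ) = -(τ / 2) by ring, thetaZ_neg, c1]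
  have a4 : thetaZ τ (τ / 2 - (τ + 2)) = thetaZ τ (τ / 2 + 2) / nomeK τ := by
    rw [show (τ / 2 - (τ + 2) : ℂ) = -(τ / 2 + 2) by ring, thetaZ_neg, expQuarter_add, c1,
      expQuarter_two]
    ring
  have a5 : thetaZ τ (1 / 2 - (2 * τ + 1)) =
      -thetaZ τ (2 * τ + 1 / 2) / (zeta8 * nomeK τ ^ 4) := by
    rw [show (1 / 2 - (2 * τ + 1) : ℂ) = -(2 * τ + 1 / 2) by ring, thetaZ_neg, expQuarter_add, c0,
      expQuarter_two_mul, mul_comm (nomeK τ ^ 4)]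
  -- The two arguments add up to 4τ + 4, so the reflection `thetaProd_div` exchanges them.
  have a6 : thetaZ τ (1 / 2 + (2 * τ + 1)) = thetaZ τ (2 * τ + 1 / 2 + 2) := by
    rw [thetaZ, thetaZ, ← thetaProd_div _ Q0, nomeQ_eq, add_left_comm, expQuarter_add,
      expQuarter_add, expQuarter_add (2 * τ + 1 / 2), expQuarter_add (2 * τ),
      expQuarter_two_mul, expQuarter_one, expQuarter_two, c0]
    congr 1
    field_simp
    linear_combination zeta8_pow_four
  have a7 : thetaZ τ (1 / 2 - 1) = -thetaZ τ (1 / 2) / zeta8 := by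
    rw [show (1 / 2 - 1 : ℂ) = -(1 / 2) by ring, thetaZ_neg, c0]
  have a8 : thetaZ τ (1 / 2 + 1) = thetaZ τ (1 / 2 + 2) / zeta8 := by
    rw [show (1 / 2 + 1 : ℂ) = -(1 / 2 + 2) + 4 by ring, thetaZ_add_four, thetaZ_neg,
      expQuarter_add, c0, expQuarter_two]
    ring
  have a9 : thetaZ τ (τ / 2 - 1) = thetaZ τ (τ / 2 + 1 + 2) := by
    rw [← thetaZ_add_four]; congr 1; ring
  have a10 : thetaZ τ (τ / 2 - (2 * τ + 1)) =
      -thetaZ τ (τ / 2 + τ + 1) / (zeta8 ^ 2 * nomeK τ ^ 3) := by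
    rw [show (τ / 2 - (2 * τ + 1) : ℂ) = -(τ / 2 + τ + 1) by ring, thetaZ_neg, expQuarter_add,
      expQuarter_add, c1, expQuarter_self, expQuarter_one]
    ring
  have a11 : thetaZ τ (τ / 2 + (2 * τ + 1)) = thetaZ τ (τ / 2 + τ + 1 + 2) := by
    rw [thetaZ, thetaZ, ← thetaProd_div _ Q0, nomeQ_eq, expQuarter_add,
      expQuarter_add (τ / 2 + τ + 1), expQuarter_add (τ / 2 + τ), expQuarter_add (τ / 2) τ, c3, c1,
      expQuarter_one, expQuarter_two, expQuarter_self]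
    congr 1
    field_simp
    linear_combination zeta8_pow_four
  have p1 : thetaZ τ (τ / 2) * thetaZ τ (τ / 2 + 2) *
      (thetaZ τ (τ / 2 + τ) * thetaZ τ (τ / 2 + (τ + 2))) = thetaZ τ τ := by
    rw [thetaZ_self, ← thetaProd_mul_four hk k0]
    simp only [thetaZ, expQuarter_add, c1, expQuarter_self, expQuarter_two, nomeQ_eq]
    ring_nf
  have p2 : thetaZ τ (τ / 2 + 1) * thetaZ τ (τ / 2 + 1 + 2) *
      (thetaZ τ (τ / 2 + τ + 1) * thetaZ τ (τ / 2 + τ + 1 + 2)) = thetaZ τ (τ + 2) := by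
    -- Adding 1 to the argument multiplies `expQuarter` by `I`, and the eighth power is unaffected.
    -- This is therefore `thetaProd_mul_four` at `I * nomeK τ`.
    have h1 : ‖Complex.I * nomeK τ‖ < 1 := by simpa using hk
    have h2 := thetaProd_mul_four h1 (mul_ne_zero Complex.I_ne_zero k0)
    have h3 : (Complex.I * nomeK τ) ^ 8 = nomeK τ ^ 8 := by
      rw [mul_pow, show Complex.I ^ 8 = (Complex.I ^ 2) ^ 4 by ring, Complex.I_sq]; ring
    have h4 : (Complex.I * nomeK τ) ^ 3 = -(Complex.I * nomeK τ ^ 3) := by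
      rw [mul_pow, Complex.I_pow_three]; ring
    have h5 : (Complex.I * nomeK τ) ^ 2 = -nomeK τ ^ 2 := by
      rw [mul_pow, Complex.I_sq]; ring
    rw [h3, h4, h5, neg_neg] at h2
    rw [thetaZ_add_two, ← h2]
    simp only [thetaZ, expQuarter_add, c1, expQuarter_self, expQuarter_two, expQuarter_one,
      zeta8_sq, nomeQ_eq]
    ring_nf
  have p3 : thetaZ τ (1 / 2) * thetaZ τ (1 / 2 + 2) *
      (thetaZ τ (2 * τ + 1 / 2) * thetaZ τ (2 * τ + 1 / 2 + 2)) = thetaZ τ 1 := by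
    have h1 := thetaProd_sq_mul_thetaProd_sq (zeta8 ^ 2) hQ
    have h2 := thetaProd_mul_thetaProd_neg zeta8 hQ
    have h3 := thetaProd_mul_thetaProd_neg (nomeK τ ^ 4 * zeta8) hQ
    rw [show (nomeK τ ^ 4 * zeta8) ^ 2 = nomeQ τ * zeta8 ^ 2 by rw [nomeQ_eq]; ring] at h3
    simp only [thetaZ, expQuarter_add, c0, expQuarter_two_mul, expQuarter_two, expQuarter_one,
      mul_neg_one, h2, h3, h1]
  have hnum : ∀ {a b c : ℂ}, a * b = c → c ≠ 0 → a ≠ 0 ∧ b ≠ 0 := fun h hc =>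
    ⟨left_ne_zero_of_mul (h ▸ hc), right_ne_zero_of_mul (h ▸ hc)⟩
  obtain ⟨q1, q2⟩ := hnum p2 n4
  obtain ⟨q3, q4⟩ := mul_ne_zero_iff.1 q1
  obtain ⟨q5, q6⟩ := mul_ne_zero_iff.1 q2
  rw [← thetaZ_self, ← thetaZ_add_two]
  have t2 := thetaZ_two_mul τ
  rw [← thetaZ_self, ← thetaZ_add_two] at t2
  rw [burnsideY, wp_sub_wp (notMem_self τ) (notMem_two_mul τ),
    wp_sub_wp (notMem_half_mul τ) (notMem_self τ), wp_sub_wp (notMem_half_mul τ) (notMem_add_two τ),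
    wp_sub_wp (notMem_half τ) (notMem_two_mul_add_one τ), wp_sub_wp (notMem_half τ) (notMem_one τ),
    wp_sub_wp (notMem_half_mul τ) (notMem_one τ),
    wp_sub_wp (notMem_half_mul τ) (notMem_two_mul_add_one τ), wpDeriv_eq (notMem_half τ),
    wpDeriv_eq (notMem_self τ), c2, c3, c0, expQuarter_self, expQuarter_two_mul, expQuarter_one,
    a1, a2, a3, a4, a5, a6, a7, a8, a9, a10, a11, show (2 * (1 / 2) : ℂ) = 1 by norm_num,
    ← zeta8_sq]
  generalize thetaZ τ (1 / 2) = z1 at *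
  generalize thetaZ τ (1 / 2 + 2) = z2 at *
  generalize thetaZ τ (2 * τ + 1 / 2) = z3 at *
  generalize thetaZ τ (2 * τ + 1 / 2 + 2) = z4 at *
  generalize thetaZ τ (τ / 2) = u1 at *
  generalize thetaZ τ (τ / 2 + 2) = u2 at *
  generalize thetaZ τ (τ / 2 + τ) = u3 at *
  generalize thetaZ τ (τ / 2 + (τ + 2)) = u4 at *
  generalize thetaZ τ (τ / 2 + 1) = v1 at *
  generalize thetaZ τ (τ / 2 + 1 + 2) = v2 at *
  generalize thetaZ τ (τ / 2 + τ + 1) = v3 at *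
  generalize thetaZ τ (τ / 2 + τ + 1 + 2) = v4 at *
  generalize thetaZ τ τ = A at *
  generalize thetaZ τ (τ + 2) = B at *
  generalize thetaZ τ 1 = i1 at *
  generalize thetaZ τ (2 * τ) = t at *
  generalize thetaZ τ (2 * τ + 1) = s at *
  generalize thetaZDeriv τ = D at *
  generalize nomeK τ = k at *
  generalize zeta8 = w at *
  -- All cancellations done, with the remaining factors arranged in the groups that `p1`, `p2` and
  -- `p3` evaluate.
  trans (-4 * k * A ^ 2 * (u1 * u2 * (u3 * u4)) * (z1 * z2 * (z3 * z4))) /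
      (t ^ 3 * B ^ 2 * i1 * (v1 * v2 * (v3 * v4)))
  · field_simp
  · rw [p1, p2, p3, t2]
    field_simp

/-! ### Jacobi's identity and the curve equation -/

/-- Lets an identity in a free variable t of the punctured unit disc be read off from the lattice of
a suitable τ. -/
theorem exists_nomeK_pow_four {q : ℂ} (hq : ‖q‖ < 1) (h0 : q ≠ 0) : ∃ τ : ℍ, nomeK τ ^ 4 = q := by
  have hlog : Real.log ‖q‖ < 0 := Real.log_neg (norm_pos_iff.2 h0) hq
  have hpi := Real.pi_pos
  have hpiI : (Real.pi * Complex.I : ℂ) ≠ 0 := by simp [Real.pi_ne_zero]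
  have him : 0 < (Complex.log q / (Real.pi * Complex.I)).im := by
    have : Complex.log q / (Real.pi * Complex.I) =
        (1 / Real.pi : ℝ) * (-(Complex.I * Complex.log q)) := by
      push_cast
      field_simp
      rw [Complex.I_sq]; ring
    rw [this, Complex.im_ofReal_mul]
    simp only [Complex.neg_im, Complex.mul_im, Complex.I_re, Complex.I_im, Complex.log_re]
    have : 0 < 1 / Real.pi := by positivity
    nlinarith
  refine ⟨⟨_, him⟩, ?_⟩
  rw [← expQuarter_two_mul, expQuarter]
  rw [show (Real.pi * Complex.I / 2 * (2 * ((⟨_, him⟩ : ℍ) : ℂ)) : ℂ) = Complex.log q by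
    change (Real.pi * Complex.I / 2 * (2 * (Complex.log q / (Real.pi * Complex.I))) : ℂ) = _
    field_simp, Complex.exp_log h0]

/-- Jacobi's identity `∏ (1 + t^(2n+1))⁸ - ∏ (1 - t^(2n+1))⁸ = 16 t ∏ (1 + t^(2n+2))⁸`. -/
theorem oddProd_neg_pow_eight_sub {t : ℂ} (ht : ‖t‖ < 1) (h0 : t ≠ 0) :
    oddProd (-t) ^ 8 - oddProd t ^ 8 = 16 * t * evenProd t ^ 8 := by
  obtain ⟨τ, rfl⟩ := exists_nomeK_pow_four ht h0
  have hQ := norm_nomeQ_lt_one τ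
  have n2 := thetaZ_ne_zero (notMem_two τ)
  have n6 := thetaZ_ne_zero (notMem_two_mul τ)
  have n7 := thetaZ_ne_zero (notMem_two_mul_add_two τ)
  have hD := thetaZDeriv_ne_zero τ
  have k0 := nomeK_ne_zero τ
  have c1 : expQuarter (2 * τ + 2) = -nomeK τ ^ 4 := by
    rw [expQuarter_add, expQuarter_two, expQuarter_two_mul]; ring
  have a1 : thetaZ τ (2 - 2 * τ) = thetaZ τ (2 * τ + 2) / nomeK τ ^ 4 := by
    rw [show (2 - 2 * τ : ℂ) = -(2 * τ + 2) + 4 by ring, thetaZ_add_four, thetaZ_neg, c1]; ring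
  have a2 : thetaZ τ (2 - (2 * τ + 2)) = -thetaZ τ (2 * τ) / nomeK τ ^ 4 := by
    rw [show (2 - (2 * τ + 2) : ℂ) = -(2 * τ) by ring, thetaZ_neg, expQuarter_two_mul]
  have a3 : thetaZ τ (2 + (2 * τ + 2)) = thetaZ τ (2 * τ) := by
    rw [show (2 + (2 * τ + 2) : ℂ) = 2 * τ + 4 by ring, thetaZ_add_four]
  have a4 : thetaZ τ (2 * τ - (2 * τ + 2)) = thetaZ τ 2 := by
    rw [show (2 * τ - (2 * τ + 2) : ℂ) = -2 by ring, thetaZ_neg, expQuarter_two]; ring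
  have a5 : thetaZ τ (2 * τ + (2 * τ + 2)) = thetaZ τ 2 := by
    rw [show (2 * τ + (2 * τ + 2) : ℂ) = 2 + 4 * τ by ring, thetaZ_add_four_mul,
      expQuarter_two]; ring
  have h1 := wp_sub_wp (notMem_two τ) (notMem_two_mul τ)
  have h2 := wp_sub_wp (notMem_two τ) (notMem_two_mul_add_two τ)
  have h3 := wp_sub_wp (notMem_two_mul τ) (notMem_two_mul_add_two τ)
  rw [a1, add_comm 2 (2 * (τ : ℂ)), expQuarter_two_mul] at h1
  rw [a2, a3, c1] at h2
  rw [a4, a5, c1] at h3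
  -- With e₁, e₂, e₃ the values of ℘ at 2, 2τ, 2τ + 2, the identity sought is e₁ - e₂ = (e₁ - e₃) -
  -- (e₂ - e₃) with each difference factored.
  have h4 := h1
  rw [show wp τ 2 - wp τ (2 * τ) = (wp τ 2 - wp τ (2 * τ + 2)) -
    (wp τ (2 * τ) - wp τ (2 * τ + 2)) by ring, h2, h3] at h4
  have e1 : thetaZ τ (2 * τ) = oddProd (nomeK τ ^ 4) ^ 2 := by
    rw [thetaZ, nomeQ_eq, expQuarter_two_mul, ← thetaProd_sq_self (pow_ne_zero 4 k0)]; ring_nf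
  have e2 : thetaZ τ (2 * τ + 2) = oddProd (-nomeK τ ^ 4) ^ 2 := by
    rw [thetaZ, nomeQ_eq, c1, ← thetaProd_sq_self (neg_ne_zero.2 (pow_ne_zero 4 k0))]; ring_nf
  have e3 : thetaZ τ 2 = 2 * evenProd (nomeK τ ^ 4) ^ 2 := by
    rw [thetaZ, expQuarter_two, thetaProd_neg_one hQ, evenProd, nomeQ_eq]; ring_nf
  generalize thetaZ τ (2 * τ + 2) = U at *
  generalize thetaZ τ (2 * τ) = V at *
  field_simp at h4
  rw [e1, e2, e3] at h4
  linear_combination h4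

/-- In the notation A, B, C, x⁵ - x = A²(B⁸ - A⁸)/B¹⁰. Jacobi's identity turns the bracket into
16k²C⁸, and Euler's identity removes C. -/
theorem burnsideY_sq (τ : ℍ) : burnsideY τ ^ 2 = burnsideX τ ^ 5 - burnsideX τ := by
  have hk := norm_pow_lt_one (norm_nomeK_lt_one τ) two_ne_zero
  have k0 := pow_ne_zero 2 (nomeK_ne_zero τ)
  have nA := oddProd_ne_zero hk
  have nB := oddProd_ne_zero (t := -nomeK τ ^ 2) (by simpa using hk)
  have hJ := oddProd_neg_pow_eight_sub hk k0
  have hE := oddProd_mul_oddProd_neg_mul_evenProd hk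
  have nC := evenProd_ne_zero hk
  have hE' : (oddProd (nomeK τ ^ 2) * oddProd (-nomeK τ ^ 2) * evenProd (nomeK τ ^ 2)) ^ 8 = 1 := by
    rw [hE, one_pow]
  rw [burnsideX_eq, burnsideY_eq]
  generalize oddProd (nomeK τ ^ 2) = A at *
  generalize oddProd (-nomeK τ ^ 2) = B at *
  generalize evenProd (nomeK τ ^ 2) = C at *
  generalize nomeK τ = k at *
  field_simp
  linear_combination (-16 * k ^ 2) * hE' - A ^ 8 * B ^ 8 * hJ

/-! ### Weber functions and their modular transformations -/

/-- The function `exp (π i w)`. -/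
def nome (w : ℂ) : ℂ := Complex.exp (Real.pi * Complex.I * w)

theorem norm_nome_lt_one {w : ℂ} (hw : 0 < w.im) : ‖nome w‖ < 1 := by
  rw [nome, Complex.norm_exp, Real.exp_lt_one_iff]
  simpa using mul_pos Real.pi_pos hw

theorem nome_sq (w : ℂ) : nome w ^ 2 = Complex.exp (2 * Real.pi * Complex.I * w) := by
  rw [nome, ← Complex.exp_nat_mul]; congr 1; push_cast; ring

theorem nome_add_one (w : ℂ) : nome (w + 1) = -nome w := by
  rw [nome, mul_add, Complex.exp_add, mul_one, Complex.exp_pi_mul_I, nome]; ring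

/-- The number `exp (π i / 24)`. -/
def omega48 : ℂ := Complex.exp (Real.pi * Complex.I / 24)

theorem omega48_ne_zero : omega48 ≠ 0 := Complex.exp_ne_zero _

theorem omega48_pow (n : ℕ) : omega48 ^ n = Complex.exp (n * (Real.pi * Complex.I / 24)) := by
  rw [omega48, Complex.exp_nat_mul]

theorem omega48_pow_12 : omega48 ^ 12 = Complex.I := by
  rw [omega48_pow, show ((12 : ℕ) : ℂ) * (Real.pi * Complex.I / 24) = Real.pi / 2 * Complex.I by
    push_cast; ring, Complex.exp_pi_div_two_mul_I]

theorem omega48_pow_24 : omega48 ^ 24 = -1 := by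
  rw [show omega48 ^ 24 = (omega48 ^ 12) ^ 2 by ring, omega48_pow_12, Complex.I_sq]

/-- The Weber function `𝔣`. -/
def weber (w : ℂ) : ℂ := Complex.exp (-(Real.pi * Complex.I / 24 * w)) * oddProd (-nome w)

/-- The Weber function `𝔣₁`. -/
def weber₁ (w : ℂ) : ℂ := Complex.exp (-(Real.pi * Complex.I / 24 * w)) * oddProd (nome w)

/-- The Weber function `𝔣₂`. -/
def weber₂ (w : ℂ) : ℂ :=
  (√2 : ℝ) * (Complex.exp (Real.pi * Complex.I / 12 * w) * evenProd (nome w))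

theorem ofReal_sqrt_two_sq : ((√2 : ℝ) : ℂ) ^ 2 = 2 := by
  rw [← Complex.ofReal_pow, Real.sq_sqrt (by norm_num)]; norm_num

theorem ofReal_sqrt_two_ne_zero : ((√2 : ℝ) : ℂ) ≠ 0 := by
  intro h; have := ofReal_sqrt_two_sq; rw [h] at this; norm_num at this

theorem weber_mul_weber₁_mul_weber₂ {w : ℂ} (hw : 0 < w.im) :
    weber w * weber₁ w * weber₂ w = (√2 : ℝ) := by
  have h := oddProd_mul_oddProd_neg_mul_evenProd (norm_nome_lt_one hw)
  have e : Complex.exp (-(Real.pi * Complex.I / 24 * w)) ^ 2 *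
      Complex.exp (Real.pi * Complex.I / 12 * w) = 1 := by
    rw [← Complex.exp_nat_mul, ← Complex.exp_add, ← Complex.exp_zero]
    congr 1; push_cast; ring
  rw [weber, weber₁, weber₂]
  linear_combination ((√2 : ℝ) : ℂ) * (oddProd (nome w) * oddProd (-nome w) * evenProd (nome w)) * e
    + ((√2 : ℝ) : ℂ) * h

theorem weber_ne_zero {w : ℂ} (hw : 0 < w.im) : weber w ≠ 0 := fun h => by
  have := weber_mul_weber₁_mul_weber₂ hw
  simp only [h, zero_mul] at this
  exact ofReal_sqrt_two_ne_zero this.symm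

theorem weber₁_ne_zero {w : ℂ} (hw : 0 < w.im) : weber₁ w ≠ 0 := fun h => by
  have := weber_mul_weber₁_mul_weber₂ hw
  simp only [h, zero_mul, mul_zero] at this
  exact ofReal_sqrt_two_ne_zero this.symm

theorem weber₂_ne_zero {w : ℂ} (hw : 0 < w.im) : weber₂ w ≠ 0 := fun h => by
  have := weber_mul_weber₁_mul_weber₂ hw
  simp only [h, mul_zero] at this
  exact ofReal_sqrt_two_ne_zero this.symm

theorem eta_eq_poch (w : ℂ) : ModularForm.eta w =
    Complex.exp (Real.pi * Complex.I / 12 * w) * poch (nome w ^ 2) (nome w ^ 2) := by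
  rw [ModularForm.eta, poch, Function.Periodic.qParam]
  congr 1
  · congr 1; push_cast; ring
  · congr 1; ext n
    rw [ModularForm.eta_q_eq_pow, nome_sq, ← pow_succ']

/-- Expresses the Weber function as an eta quotient, so that the inversion law of η can be
transferred to it. -/
theorem weber₁_mul_eta {w : ℂ} (hw : 0 < w.im) :
    weber₁ w * ModularForm.eta w = ModularForm.eta (w / 2) := by
  have h := oddProd_mul_poch (norm_nome_lt_one hw)
  have e : nome (w / 2) ^ 2 = nome w := by
    rw [nome_sq, nome]; congr 1; ring
  have e' : Complex.exp (Real.pi * Complex.I / 12 * (w / 2)) =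
      Complex.exp (-(Real.pi * Complex.I / 24 * w)) *
        Complex.exp (Real.pi * Complex.I / 12 * w) := by
    rw [← Complex.exp_add]; congr 1; ring
  rw [eta_eq_poch, eta_eq_poch, e, ← h, weber₁, e']
  ring

theorem weber₂_mul_eta {w : ℂ} (hw : 0 < w.im) :
    weber₂ w * ModularForm.eta w = (√2 : ℝ) * ModularForm.eta (2 * w) := by
  have h := evenProd_mul_poch (norm_nome_lt_one hw)
  have e : nome (2 * w) ^ 2 = nome w ^ 4 := by
    rw [nome_sq, nome, ← Complex.exp_nat_mul]; congr 1; push_cast; ring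
  have e' : Complex.exp (Real.pi * Complex.I / 12 * (2 * w)) =
      Complex.exp (Real.pi * Complex.I / 12 * w) * Complex.exp (Real.pi * Complex.I / 12 * w) := by
    rw [← Complex.exp_add]; congr 1; ring
  rw [eta_eq_poch, eta_eq_poch, e, ← h, weber₂, e']
  ring

theorem im_neg_one_div_pos {w : ℂ} (hw : 0 < w.im) : 0 < (-1 / w).im := by
  have h0 : w ≠ 0 := by rintro rfl; simp at hw
  rw [Complex.div_im]
  simp only [Complex.neg_im, Complex.one_im, Complex.neg_re, Complex.one_re]
  have := Complex.normSq_pos.2 h0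
  have := div_pos hw this
  simp only [neg_zero, zero_mul, zero_div, zero_sub, neg_mul, one_mul, neg_div, neg_neg]
  exact this

/-- A positive real factor leaves the argument unchanged, so the principal branch is multiplicative
here. -/
theorem csqrt_two_mul {w : ℂ} (hw : w ≠ 0) :
    Complex.sqrt (2 * w) = (√2 : ℝ) * Complex.sqrt w := by
  have h2 : (2 : ℂ) * w ≠ 0 := mul_ne_zero two_ne_zero hw
  have hlog := Complex.log_ofReal_mul (r := 2) two_pos hw
  push_cast at hlog
  have hs : (√2 : ℝ) = Real.exp (Real.log 2 / 2) := by
    rw [← Real.log_sqrt (by norm_num), Real.exp_log (by positivity)]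
  rw [Complex.sqrt, Complex.sqrt, Complex.cpow_def_of_ne_zero h2, Complex.cpow_def_of_ne_zero hw,
    hlog, hs, Complex.ofReal_exp, ← Complex.exp_add]
  congr 1
  push_cast
  ring

theorem eta_neg_one_div {w : ℂ} (hw : 0 < w.im) :
    ModularForm.eta (-1 / w) = (Complex.sqrt Complex.I)⁻¹ * (Complex.sqrt w * ModularForm.eta w) :=
  ModularForm.eta_comp_eq_csqrt_I_inv hw

/-- Here 𝔣₁(-1/w) = η(-1/(2w))/η(-1/w). Inverting both etas leaves √(2w)η(2w)/(√w η(w)), which is √2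
η(2w)/η(w) = 𝔣₂(w). -/
theorem weber₁_neg_one_div {w : ℂ} (hw : 0 < w.im) : weber₁ (-1 / w) = weber₂ w := by
  have h0 : w ≠ 0 := by rintro rfl; simp at hw
  have h2 : 0 < (2 * w).im := by simpa using hw
  have h1 := weber₁_mul_eta (im_neg_one_div_pos hw)
  rw [show -1 / w / 2 = -1 / (2 * w) by field_simp, eta_neg_one_div hw, eta_neg_one_div h2,
    csqrt_two_mul h0] at h1
  have h3 := weber₂_mul_eta hw
  have n1 : Complex.sqrt Complex.I ≠ 0 := by
    simp [Complex.sqrt, Complex.cpow_eq_zero_iff]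
  have n2 : Complex.sqrt w ≠ 0 := by
    simp [Complex.sqrt, Complex.cpow_eq_zero_iff, h0]
  have n3 := ModularForm.eta_ne_zero hw
  apply mul_right_cancel₀ n3
  rw [h3]
  generalize weber₁ (-1 / w) = x at *
  generalize ModularForm.eta (2 * w) = y at *
  field_simp at h1
  exact h1

theorem weber₂_neg_one_div {w : ℂ} (hw : 0 < w.im) : weber₂ (-1 / w) = weber₁ w := by
  have h0 : w ≠ 0 := by rintro rfl; simp at hw
  rw [← weber₁_neg_one_div (im_neg_one_div_pos hw)]
  congr 1
  field_simp

/-- Follows from the exchange of the other two functions, since the product of all three is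
constant. -/
theorem weber_neg_one_div {w : ℂ} (hw : 0 < w.im) : weber (-1 / w) = weber w := by
  have h1 := weber_mul_weber₁_mul_weber₂ hw
  have h2 := weber_mul_weber₁_mul_weber₂ (im_neg_one_div_pos hw)
  rw [weber₁_neg_one_div hw, weber₂_neg_one_div hw, ← h1] at h2
  apply mul_right_cancel₀ (mul_ne_zero (weber₁_ne_zero hw) (weber₂_ne_zero hw))
  linear_combination h2

theorem exp_neg_mul_add_one (w : ℂ) : Complex.exp (-(Real.pi * Complex.I / 24 * (w + 1))) =
    omega48⁻¹ * Complex.exp (-(Real.pi * Complex.I / 24 * w)) := by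
  rw [omega48, ← Complex.exp_neg, ← Complex.exp_add]; congr 1; ring

theorem weber_add_one (w : ℂ) : weber (w + 1) = omega48⁻¹ * weber₁ w := by
  rw [weber, weber₁, nome_add_one, neg_neg, exp_neg_mul_add_one, mul_assoc]

theorem weber₁_add_one (w : ℂ) : weber₁ (w + 1) = omega48⁻¹ * weber w := by
  rw [weber, weber₁, nome_add_one, exp_neg_mul_add_one, mul_assoc]

theorem weber₂_add_one (w : ℂ) : weber₂ (w + 1) = omega48 ^ 2 * weber₂ w := by
  have : Complex.exp (Real.pi * Complex.I / 12 * (w + 1)) =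
      omega48 ^ 2 * Complex.exp (Real.pi * Complex.I / 12 * w) := by
    rw [omega48_pow, ← Complex.exp_add]; congr 1; push_cast; ring
  rw [weber₂, weber₂, nome_add_one, evenProd_neg, this]
  ring

/-- The values of the three Weber functions at a point of the upper half-plane. -/
structure WeberValues (w a b c : ℂ) : Prop where
  im_pos : 0 < w.im
  weber_eq : weber w = a
  weber₁_eq : weber₁ w = b
  weber₂_eq : weber₂ w = c

theorem WeberValues.add_one {w a b c : ℂ} (h : WeberValues w a b c) :
    WeberValues (w + 1) (omega48⁻¹ * b) (omega48⁻¹ * a) (omega48 ^ 2 * c) where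
  im_pos := by simpa using h.im_pos
  weber_eq := by rw [weber_add_one, h.weber₁_eq]
  weber₁_eq := by rw [weber₁_add_one, h.weber_eq]
  weber₂_eq := by rw [weber₂_add_one, h.weber₂_eq]

theorem WeberValues.sub_one {w a b c : ℂ} (h : WeberValues w a b c) :
    WeberValues (w - 1) (omega48 * b) (omega48 * a) ((omega48 ^ 2)⁻¹ * c) := by
  have n := omega48_ne_zero
  have e1 := weber_add_one (w - 1)
  have e2 := weber₁_add_one (w - 1)
  have e3 := weber₂_add_one (w - 1)
  rw [sub_add_cancel] at e1 e2 e3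
  refine ⟨by simpa using h.im_pos, ?_, ?_, ?_⟩
  · rw [← h.weber₁_eq, e2]; field_simp
  · rw [← h.weber_eq, e1]; field_simp
  · rw [← h.weber₂_eq, e3]; field_simp

theorem WeberValues.neg_one_div {w a b c : ℂ} (h : WeberValues w a b c) :
    WeberValues (-1 / w) a c b where
  im_pos := im_neg_one_div_pos h.im_pos
  weber_eq := by rw [weber_neg_one_div h.im_pos, h.weber_eq]
  weber₁_eq := by rw [weber₁_neg_one_div h.im_pos, h.weber₂_eq]
  weber₂_eq := by rw [weber₂_neg_one_div h.im_pos, h.weber₁_eq]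

theorem WeberValues.ne_zero {w a b c : ℂ} (h : WeberValues w a b c) : a ≠ 0 ∧ b ≠ 0 ∧ c ≠ 0 :=
  ⟨h.weber_eq ▸ weber_ne_zero h.im_pos, h.weber₁_eq ▸ weber₁_ne_zero h.im_pos,
    h.weber₂_eq ▸ weber₂_ne_zero h.im_pos⟩

theorem weberValues_half (τ : ℍ) :
    WeberValues (τ / 2) (weber (τ / 2)) (weber₁ (τ / 2)) (weber₂ (τ / 2)) :=
  ⟨by simpa using τ.im_pos, rfl, rfl, rfl⟩

theorem nome_half (τ : ℍ) : nome (τ / 2) = nomeK τ ^ 2 := by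
  rw [← expQuarter_self, nome, expQuarter]; congr 1; ring

theorem burnsideX_eq_weber (τ : ℍ) :
    burnsideX τ = -(weber₁ (τ / 2) / weber (τ / 2)) ^ 2 := by
  rw [burnsideX_eq, weber₁, weber, nome_half, mul_div_mul_left _ _ (Complex.exp_ne_zero _)]

/-- With e = exp(πi(τ/2)/24), the prefactors contribute e⁸ · e⁻¹ · e⁵ = e¹² = `nomeK τ` and √2⁴ = 4;
Euler's identity eliminates the even product. -/
theorem burnsideY_eq_weber (τ : ℍ) :
    burnsideY τ = -(weber₂ (τ / 2) ^ 4 * weber₁ (τ / 2) / weber (τ / 2) ^ 5) := by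
  have hk := norm_pow_lt_one (norm_nomeK_lt_one τ) two_ne_zero
  have nA := oddProd_ne_zero hk
  have nB := oddProd_ne_zero (t := -nomeK τ ^ 2) (by simpa using hk)
  have hE := oddProd_mul_oddProd_neg_mul_evenProd hk
  have hC : evenProd (nomeK τ ^ 2) =
      1 / (oddProd (nomeK τ ^ 2) * oddProd (-nomeK τ ^ 2)) := by
    field_simp
    linear_combination hE
  set e := Complex.exp (Real.pi * Complex.I / 24 * (τ / 2)) with he
  have h1 : Complex.exp (-(Real.pi * Complex.I / 24 * (τ / 2))) = e⁻¹ := Complex.exp_neg _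
  have h2 : Complex.exp (Real.pi * Complex.I / 12 * (τ / 2)) = e ^ 2 := by
    rw [he, ← Complex.exp_nat_mul]; congr 1; push_cast; ring
  have h3 : nomeK τ = e ^ 12 := by
    rw [he, ← Complex.exp_nat_mul, nomeK, expQuarter]; congr 1; push_cast; ring
  have h4 : e ≠ 0 := Complex.exp_ne_zero _
  have h5 := ofReal_sqrt_two_sq
  rw [burnsideY_eq, weber₂, weber₁, weber, nome_half, h1, h2, hC, h3]
  rw [h3] at nA nB
  field_simp
  rw [show ((√2 : ℝ) : ℂ) ^ 4 = (((√2 : ℝ) : ℂ) ^ 2) ^ 2 by ring, h5]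
  ring

/-! ### Closed forms of the series in the transformed variable -/

/-- The series of `x` at a cusp over a branch point with finite nonzero abscissa. -/
def branchSeriesX (t : ℂ) : ℂ := oddProd (-t) ^ 4 * evenProd t ^ 2

/-- The series of `y` at a cusp over a branch point with finite nonzero abscissa. -/
def branchSeriesY (t : ℂ) : ℂ := evenProd t ^ 9 * oddProd (-t) ^ 6

/-- The series of `x` at its pole. -/
def poleSeriesX (t : ℂ) : ℂ := oddProd (-t) ^ 4 * oddProd t ^ 2

/-- The series of `y` at its pole. -/
def poleSeriesY (t : ℂ) : ℂ := oddProd t ^ 9 * oddProd (-t) ^ 6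

/-- The series of `x` at its zero. -/
def zeroSeriesX (t : ℂ) : ℂ := evenProd t ^ 4 * oddProd (-t) ^ 2

/-- The series of `y` at its zero. -/
def zeroSeriesY (t : ℂ) : ℂ := oddProd (-t) ^ 9 * evenProd t ^ 6

section

variable {σ a b c : ℂ}

/-- Expresses everything through one exponential and two nonvanishing products, so that each
identity below is a comparison of exponents. -/
theorem WeberValues.eq_exp (h : WeberValues σ a b c) : ∃ e : ℂ,
    e ≠ 0 ∧ (∀ n : ℕ, e ^ n = Complex.exp (n * (Real.pi * Complex.I / 24 * σ))) ∧
    oddProd (nome σ) ≠ 0 ∧ oddProd (-nome σ) ≠ 0 ∧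
    evenProd (nome σ) = 1 / (oddProd (nome σ) * oddProd (-nome σ)) ∧
    a = e⁻¹ * oddProd (-nome σ) ∧ b = e⁻¹ * oddProd (nome σ) ∧
    c = (√2 : ℝ) * (e ^ 2 * evenProd (nome σ)) := by
  have hk := norm_nome_lt_one h.im_pos
  have nA := oddProd_ne_zero hk
  have nB := oddProd_ne_zero (t := -nome σ) (by simpa using hk)
  have hE := oddProd_mul_oddProd_neg_mul_evenProd hk
  refine ⟨Complex.exp (Real.pi * Complex.I / 24 * σ), Complex.exp_ne_zero _,
    fun n => (Complex.exp_nat_mul _ _).symm, nA, nB, ?_, ?_, ?_, ?_⟩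
  · field_simp; linear_combination hE
  · rw [← h.weber_eq, weber, Complex.exp_neg]
  · rw [← h.weber₁_eq, weber₁, Complex.exp_neg]
  · rw [← h.weber₂_eq, weber₂, ← Complex.exp_nat_mul]; congr 3; push_cast; ring

theorem WeberValues.branchX (h : WeberValues σ a b c) :
    (a / b) ^ 2 = branchSeriesX (nome σ) := by
  obtain ⟨e, he, -, nA, nB, hC, ha, hb, -⟩ := h.eq_exp
  rw [branchSeriesX, hC, ha, hb]
  field_simp

theorem WeberValues.branchY (h : WeberValues σ a b c) : c ^ 4 * a / b ^ 5 =
    4 * Complex.exp (Real.pi * Complex.I / 2 * σ) * branchSeriesY (nome σ) := by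
  obtain ⟨e, he, hn, nA, nB, hC, ha, hb, hc⟩ := h.eq_exp
  have h5 := ofReal_sqrt_two_sq
  rw [show Real.pi * Complex.I / 2 * σ = (12 : ℕ) * (Real.pi * Complex.I / 24 * σ) by
    push_cast; ring, ← hn, branchSeriesY, ha, hb, hc, hC]
  field_simp
  rw [show ((√2 : ℝ) : ℂ) ^ 4 = (((√2 : ℝ) : ℂ) ^ 2) ^ 2 by ring, h5]
  ring

theorem WeberValues.poleX (h : WeberValues σ a b c) : (a / c) ^ 2 =
    1 / 2 * (Complex.exp (Real.pi * Complex.I / 8 * σ) ^ 2)⁻¹ * poleSeriesX (nome σ) := by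
  obtain ⟨e, he, hn, nA, nB, hC, ha, hb, hc⟩ := h.eq_exp
  have h5 := ofReal_sqrt_two_sq
  have h6 := ofReal_sqrt_two_ne_zero
  rw [show Real.pi * Complex.I / 8 * σ = (3 : ℕ) * (Real.pi * Complex.I / 24 * σ) by
    push_cast; ring, ← hn, poleSeriesX, ha, hc, hC]
  field_simp
  rw [h5]

theorem WeberValues.poleY (h : WeberValues σ a b c) : b ^ 4 * a / c ^ 5 =
    (√2 : ℝ) / 8 * (Complex.exp (Real.pi * Complex.I / 8 * σ) ^ 5)⁻¹ * poleSeriesY (nome σ) := by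
  obtain ⟨e, he, hn, nA, nB, hC, ha, hb, hc⟩ := h.eq_exp
  have h5 := ofReal_sqrt_two_sq
  have h6 := ofReal_sqrt_two_ne_zero
  rw [show Real.pi * Complex.I / 8 * σ = (3 : ℕ) * (Real.pi * Complex.I / 24 * σ) by
    push_cast; ring, ← hn, poleSeriesY, ha, hb, hc, hC]
  field_simp
  rw [show ((√2 : ℝ) : ℂ) ^ 6 = (((√2 : ℝ) : ℂ) ^ 2) ^ 3 by ring, h5]
  norm_num

theorem WeberValues.zeroX (h : WeberValues σ a b c) : (c / b) ^ 2 =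
    2 * Complex.exp (Real.pi * Complex.I / 8 * σ) ^ 2 * zeroSeriesX (nome σ) := by
  obtain ⟨e, he, hn, nA, nB, hC, ha, hb, hc⟩ := h.eq_exp
  have h5 := ofReal_sqrt_two_sq
  rw [show Real.pi * Complex.I / 8 * σ = (3 : ℕ) * (Real.pi * Complex.I / 24 * σ) by
    push_cast; ring, ← hn, zeroSeriesX, hb, hc, hC]
  field_simp
  rw [h5]

theorem WeberValues.zeroY (h : WeberValues σ a b c) : a ^ 4 * c / b ^ 5 =
    (√2 : ℝ) * Complex.exp (Real.pi * Complex.I / 8 * σ) * zeroSeriesY (nome σ) := by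
  obtain ⟨e, he, hn, nA, nB, hC, ha, hb, hc⟩ := h.eq_exp
  rw [show Real.pi * Complex.I / 8 * σ = (3 : ℕ) * (Real.pi * Complex.I / 24 * σ) by
    push_cast; ring, ← hn, zeroSeriesY, ha, hb, hc, hC]
  field_simp

end

theorem norm_exp_mul_lt_one {r : ℝ} (hr : 0 < r) {σ : ℂ} (hσ : 0 < σ.im) :
    ‖Complex.exp (Real.pi * Complex.I / r * σ)‖ < 1 := by
  rw [Complex.norm_exp, Real.exp_lt_one_iff,
    show (Real.pi * Complex.I / r * σ : ℂ) = ((Real.pi / r : ℝ) : ℂ) * (Complex.I * σ) by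
      push_cast; ring, Complex.re_ofReal_mul, Complex.I_mul_re]
  have : 0 < Real.pi / r := by positivity
  nlinarith

/-- The expansions of `x` and `y` at a cusp over a branch point `ε`, in closed form. -/
theorem branch_expansion {q σ a b c ε δ x y : ℂ} (h : WeberValues σ a b c)
    (hq : q = Complex.exp (Real.pi * Complex.I / 2 * σ)) (hx : x = ε * (a / b) ^ 2)
    (hy : y = δ * (c ^ 4 * a / b ^ 5)) :
    ‖q‖ < 1 ∧ x = ε * q ^ (0 : ℤ) * branchSeriesX (q ^ 2) ∧
      y = 4 * δ * q ^ (1 : ℤ) * branchSeriesY (q ^ 2) := by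
  have hn : q ^ 2 = nome σ := by
    rw [hq, nome, ← Complex.exp_nat_mul]; congr 1; push_cast; ring
  refine ⟨?_, ?_, ?_⟩
  · simpa [hq] using norm_exp_mul_lt_one two_pos h.im_pos
  · rw [hn, hx, h.branchX, zpow_zero, mul_one]
  · rw [hn, hy, h.branchY, zpow_one, hq]; ring

theorem pole_expansion {q σ a b c x y : ℂ} (h : WeberValues σ a b c)
    (hq : q = Complex.exp (Real.pi * Complex.I / 8 * σ)) (hx : x = (a / c) ^ 2)
    (hy : y = b ^ 4 * a / c ^ 5) :
    ‖q‖ < 1 ∧ x = 1 / 2 * q ^ (-2 : ℤ) * poleSeriesX (q ^ 8) ∧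
      y = (√2 : ℝ) / 8 * q ^ (-5 : ℤ) * poleSeriesY (q ^ 8) := by
  have hn : q ^ 8 = nome σ := by
    rw [hq, nome, ← Complex.exp_nat_mul]; congr 1; push_cast; ring
  refine ⟨?_, ?_, ?_⟩
  · simpa [hq] using norm_exp_mul_lt_one (r := 8) (by norm_num) h.im_pos
  · rw [hn, hx, h.poleX, hq]; rfl
  · rw [hn, hy, h.poleY, hq]; rfl

theorem zero_expansion {q σ a b c ε δ x y : ℂ} (h : WeberValues σ a b c)
    (hq : q = Complex.exp (Real.pi * Complex.I / 8 * σ)) (hx : x = ε * (c / b) ^ 2)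
    (hy : y = δ * (a ^ 4 * c / b ^ 5)) :
    ‖q‖ < 1 ∧ x = 2 * ε * q ^ (2 : ℤ) * zeroSeriesX (q ^ 8) ∧
      y = δ * (√2 : ℝ) * q ^ (1 : ℤ) * zeroSeriesY (q ^ 8) := by
  have hn : q ^ 8 = nome σ := by
    rw [hq, nome, ← Complex.exp_nat_mul]; congr 1; push_cast; ring
  refine ⟨?_, ?_, ?_⟩
  · simpa [hq] using norm_exp_mul_lt_one (r := 8) (by norm_num) h.im_pos
  · rw [hn, hx, h.zeroX, ← hq, zpow_ofNat]; ring
  · rw [hn, hy, h.zeroY, ← hq, zpow_one]; ring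

/-! ### Carrying each cusp to infinity -/

theorem ne_zero_of_im_ne_zero {z : ℂ} (h : z.im ≠ 0) : z ≠ 0 := by
  rintro rfl; simp at h

section

variable (τ : ℍ)

theorem mul_add_ne_zero (c d : ℤ) (h : c ≠ 0 ∨ d ≠ 0) : (c * τ + d : ℂ) ≠ 0 := by
  by_cases hc : c = 0
  · subst hc
    simpa using h
  · apply ne_zero_of_im_ne_zero
    simpa [hc] using τ.im_pos.ne'

/-- The word in w ↦ w ± 1 and w ↦ -1/w, applied to τ/2, must produce the σ that matches the
prescribed q. Write q = exp(πi m/4): over the points ±1, ±i this means σ = m/2, and at the pole and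
the zero σ = 2m. Here σ = τ/2 - 1. -/
theorem expansion_infty : ‖cuspParam 1 (-2) 0 1 τ‖ < 1 ∧
    burnsideX τ = -1 * cuspParam 1 (-2) 0 1 τ ^ (0 : ℤ) *
      branchSeriesX (cuspParam 1 (-2) 0 1 τ ^ 2) ∧
    burnsideY τ = 4 * -Complex.I * cuspParam 1 (-2) 0 1 τ ^ (1 : ℤ) *
      branchSeriesY (cuspParam 1 (-2) 0 1 τ ^ 2) := by
  have h := (weberValues_half τ).sub_one
  obtain ⟨na, nb, nc⟩ := (weberValues_half τ).ne_zero
  have nw := omega48_ne_zero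
  refine branch_expansion h ?_ ?_ ?_
  · rw [cuspParam]; congr 1; push_cast; ring
  · rw [burnsideX_eq_weber]; field_simp
  · rw [burnsideY_eq_weber, ← omega48_pow_12]; field_simp

theorem expansion_one : ‖cuspParam 1 (-2) 1 (-1) τ‖ < 1 ∧
    burnsideX τ = Complex.I * cuspParam 1 (-2) 1 (-1) τ ^ (0 : ℤ) *
      branchSeriesX (cuspParam 1 (-2) 1 (-1) τ ^ 2) ∧
    burnsideY τ = 4 * omega48 ^ 6 * cuspParam 1 (-2) 1 (-1) τ ^ (1 : ℤ) *
      branchSeriesY (cuspParam 1 (-2) 1 (-1) τ ^ 2) := by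
  -- The resulting variable is (τ - 2)/(2(τ - 1)).
  have h := (weberValues_half τ).sub_one.neg_one_div.sub_one.sub_one.neg_one_div
  obtain ⟨na, nb, nc⟩ := (weberValues_half τ).ne_zero
  have nw := omega48_ne_zero
  have h24 := omega48_pow_24
  refine branch_expansion h ?_ ?_ ?_
  · have h1 := mul_add_ne_zero τ 1 (-1) (by simp)
    have h2 := mul_add_ne_zero τ 1 (-2) (by simp)
    push_cast at h1 h2
    rw [cuspParam]; congr 1; push_cast
    generalize (τ : ℂ) = t at *
    rw [one_mul, ← sub_eq_add_neg] at h1 h2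
    have h3 : (t / 2 - 1 : ℂ) ≠ 0 := by contrapose! h2; linear_combination 2 * h2
    have e : -1 / (t / 2 - 1) - 1 - 1 = -2 * (t - 1) / (t - 2) := by field_simp; ring
    rw [e, ← sub_eq_add_neg, ← sub_eq_add_neg]; field_simp; norm_num
  · rw [burnsideX_eq_weber, ← omega48_pow_12]; field_simp; exact h24.symm
  · rw [burnsideY_eq_weber]; field_simp; exact h24.symm

theorem expansion_neg_one : ‖cuspParam (-1) (-2) 1 1 τ‖ < 1 ∧
    burnsideX τ = -Complex.I * cuspParam (-1) (-2) 1 1 τ ^ (0 : ℤ) *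
      branchSeriesX (cuspParam (-1) (-2) 1 1 τ ^ 2) ∧
    burnsideY τ = 4 * (omega48 ^ 6)⁻¹ * cuspParam (-1) (-2) 1 1 τ ^ (1 : ℤ) *
      branchSeriesY (cuspParam (-1) (-2) 1 1 τ ^ 2) := by
  -- The resulting variable is -(τ + 2)/(2(τ + 1)).
  have h := (weberValues_half τ).add_one.neg_one_div.add_one.add_one.neg_one_div
  obtain ⟨na, nb, nc⟩ := (weberValues_half τ).ne_zero
  have nw := omega48_ne_zero
  have h24 := omega48_pow_24
  refine branch_expansion h ?_ ?_ ?_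
  · have h1 := mul_add_ne_zero τ 1 1 (by simp)
    have h2 := mul_add_ne_zero τ 1 2 (by simp)
    push_cast at h1 h2
    rw [cuspParam]; congr 1; push_cast
    generalize (τ : ℂ) = t at *
    rw [one_mul] at h1 h2
    have h3 : (t / 2 + 1 : ℂ) ≠ 0 := by contrapose! h2; linear_combination 2 * h2
    have e : -1 / (t / 2 + 1) + 1 + 1 = 2 * (t + 1) / (t + 2) := by field_simp; ring
    rw [e]; field_simp; ring
  · rw [burnsideX_eq_weber, ← omega48_pow_12]; field_simp
  · rw [burnsideY_eq_weber]; field_simp; rw [h24, neg_neg]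

theorem expansion_half : ‖cuspParam 3 (-2) 2 (-1) τ‖ < 1 ∧
    burnsideX τ = 1 * cuspParam 3 (-2) 2 (-1) τ ^ (0 : ℤ) *
      branchSeriesX (cuspParam 3 (-2) 2 (-1) τ ^ 2) ∧
    burnsideY τ = 4 * 1 * cuspParam 3 (-2) 2 (-1) τ ^ (1 : ℤ) *
      branchSeriesY (cuspParam 3 (-2) 2 (-1) τ ^ 2) := by
  -- The resulting variable is (3τ - 2)/(2(2τ - 1)).
  have h := (weberValues_half τ).neg_one_div.add_one.add_one.add_one.neg_one_div.sub_one.neg_one_div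
  obtain ⟨na, nb, nc⟩ := (weberValues_half τ).ne_zero
  have nw := omega48_ne_zero
  have h24 := omega48_pow_24
  refine branch_expansion h ?_ ?_ ?_
  · have h0 := mul_add_ne_zero τ 1 0 (by simp)
    have h1 := mul_add_ne_zero τ 3 (-2) (by simp)
    have h2 := mul_add_ne_zero τ 2 (-1) (by simp)
    push_cast at h0 h1 h2
    rw [cuspParam]; congr 1; push_cast
    generalize (τ : ℂ) = t at *
    rw [one_mul, add_zero] at h0
    rw [← sub_eq_add_neg] at h1 h2
    have e : -1 / (t / 2) + 1 + 1 + 1 = (3 * t - 2) / t := by field_simp; ring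
    have e' : -1 / ((3 * t - 2) / t) - 1 = -2 * (2 * t - 1) / (3 * t - 2) := by field_simp; ring
    rw [e, e', ← sub_eq_add_neg, ← sub_eq_add_neg]; field_simp; norm_num
  · rw [burnsideX_eq_weber]; field_simp; exact h24.symm
  · rw [burnsideY_eq_weber]; field_simp; exact h24.symm

theorem expansion_two : ‖cuspParam 2 (-5) 1 (-2) τ‖ < 1 ∧
    burnsideX τ = 1 / 2 * cuspParam 2 (-5) 1 (-2) τ ^ (-2 : ℤ) *
      poleSeriesX (cuspParam 2 (-5) 1 (-2) τ ^ 8) ∧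
    burnsideY τ = (√2 : ℝ) / 8 * cuspParam 2 (-5) 1 (-2) τ ^ (-5 : ℤ) *
      poleSeriesY (cuspParam 2 (-5) 1 (-2) τ ^ 8) := by
  -- The resulting variable is 4 - 2/(τ - 2). The integer part 4 does not move the cusp; it fixes
  -- the roots of unity so that the multipliers are exactly 1/2 and √2/8.
  have h := (weberValues_half τ).sub_one.neg_one_div.add_one.add_one.add_one.add_one
  obtain ⟨na, nb, nc⟩ := (weberValues_half τ).ne_zero
  have nw := omega48_ne_zero
  have h24 := omega48_pow_24
  refine pole_expansion h ?_ ?_ ?_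
  · have h2 := mul_add_ne_zero τ 1 (-2) (by simp)
    push_cast at h2
    rw [cuspParam]; congr 1; push_cast
    generalize (τ : ℂ) = t at *
    rw [one_mul, ← sub_eq_add_neg] at h2
    have e : t / 2 - 1 = (t - 2) / 2 := by ring
    rw [e, one_mul, ← sub_eq_add_neg, ← sub_eq_add_neg]; field_simp; ring
  · rw [burnsideX_eq_weber]; field_simp; rw [h24, neg_neg]
  · rw [burnsideY_eq_weber]; field_simp
    rw [show omega48 ^ 72 = (omega48 ^ 24) ^ 3 by ring, h24]; norm_num

theorem expansion_zero : ‖cuspParam 1 (-2) 2 0 τ‖ < 1 ∧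
    burnsideX τ = 2 * omega48 ^ 18 * cuspParam 1 (-2) 2 0 τ ^ (2 : ℤ) *
      zeroSeriesX (cuspParam 1 (-2) 2 0 τ ^ 8) ∧
    burnsideY τ = -(omega48 ^ 3)⁻¹ * (√2 : ℝ) * cuspParam 1 (-2) 2 0 τ ^ (1 : ℤ) *
      zeroSeriesY (cuspParam 1 (-2) 2 0 τ ^ 8) := by
  -- The resulting variable is 1 - 2/τ.
  have h := (weberValues_half τ).neg_one_div.add_one
  obtain ⟨na, nb, nc⟩ := (weberValues_half τ).ne_zero
  have nw := omega48_ne_zero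
  have h24 := omega48_pow_24
  refine zero_expansion h ?_ ?_ ?_
  · have h0 := mul_add_ne_zero τ 1 0 (by simp)
    push_cast at h0
    rw [cuspParam]; congr 1; push_cast
    generalize (τ : ℂ) = t at *
    rw [one_mul, add_zero] at h0
    rw [add_zero]; field_simp; ring
  · rw [burnsideX_eq_weber]; field_simp; exact h24.symm
  · rw [burnsideY_eq_weber]; field_simp

end

/-! ### Integrality of Taylor coefficients of infinite products -/

theorem TendstoLocallyUniformlyOn.iteratedDeriv {ι : Type*} {l : Filter ι} {U : Set ℂ}
    {F : ι → ℂ → ℂ} {f : ℂ → ℂ} (h : TendstoLocallyUniformlyOn F f l U)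
    (hF : ∀ i, Differentiable ℂ (F i)) (hU : IsOpen U) (m : ℕ) :
    TendstoLocallyUniformlyOn (fun i => iteratedDeriv m (F i)) (iteratedDeriv m f) l U := by
  induction m with
  | zero => simpa [iteratedDeriv_zero] using h
  | succ m ih =>
    simp only [iteratedDeriv_succ]
    refine ih.deriv (.of_forall fun i => ?_) hU
    exact ((hF i).contDiff (n := ⊤).differentiable_iteratedDeriv m
      (WithTop.coe_lt_top _)).differentiableOn

theorem Polynomial.iteratedDeriv_eval_zero (P : Polynomial ℂ) (m : ℕ) :
    iteratedDeriv m (fun t => P.eval t) 0 = m.factorial * P.coeff m := by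
  have h : iteratedDeriv m (fun t => P.eval t) =
      fun t => (Polynomial.derivative^[m] P).eval t := by
    induction m with
    | zero => simp [iteratedDeriv_zero]
    | succ m ih =>
      rw [iteratedDeriv_succ, ih]
      ext t
      rw [Polynomial.deriv, Function.iterate_succ_apply']
  rw [h]
  simp only
  rw [← Polynomial.coeff_zero_eq_eval_zero, Polynomial.coeff_iterate_derivative]
  simp [Nat.descFactorial_self]

/-- `f` has a power series with integer coefficients `A` in the unit disc. -/
def HasIntSeries (A : ℕ → ℤ) (f : ℂ → ℂ) : Prop :=
  ∀ t : ℂ, ‖t‖ < 1 → HasSum (fun n => (A n : ℂ) * t ^ n) (f t)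

/-- If polynomials with integer coefficients converge locally uniformly near the origin to a
function that is holomorphic in the unit disc, and their coefficients stabilize, then the limit
has integer Taylor coefficients. -/
theorem hasIntSeries_of_tendsto {P : ℕ → Polynomial ℤ} {f : ℂ → ℂ} {A : ℕ → ℤ} {U : Set ℂ}
    (hU : IsOpen U) (h0 : 0 ∈ U)
    (hP : TendstoLocallyUniformlyOn (fun N t => (P N).aeval t) f atTop U)
    (hf : DifferentiableOn ℂ f (Metric.ball 0 1))
    (hA : ∀ m, ∀ᶠ N in atTop, (P N).coeff m = A m) : HasIntSeries A f := by
  intro t ht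
  have h := Complex.hasSum_taylorSeries_on_ball hf (z := t) (by simpa using ht)
  refine (congrArg (HasSum · (f t)) (funext fun m => ?_)).mpr h
  -- By Weierstrass the m-th derivatives at the origin converge to that of `f`; by stabilization
  -- they are eventually the constant m! · `A m`.
  have h1 := (hP.iteratedDeriv (fun N => (P N).differentiable_aeval) hU m).tendsto_at h0
  have h2 : Tendsto (fun N => iteratedDeriv m (fun t : ℂ => (P N).aeval t) 0) atTop
      (𝓝 (m.factorial * (A m : ℂ))) := by
    apply tendsto_nhds_of_eventually_eq
    filter_upwards [hA m] with N hN
    have := Polynomial.iteratedDeriv_eval_zero ((P N).map (Int.castRingHom ℂ)) m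
    simp only [Polynomial.eval_map, Polynomial.coeff_map, hN] at this
    exact this
  rw [tendsto_nhds_unique h1 h2, sub_zero, smul_eq_mul, smul_eq_mul]
  have : (m.factorial : ℂ) ≠ 0 := by exact_mod_cast m.factorial_ne_zero
  field_simp

/-- The coefficients of `∏_{n < N} (1 + c t^(2n+k))`. -/
def prodCoeff (c : ℤ) (k : ℕ) : ℕ → ℕ → ℤ
  | 0, m => if m = 0 then 1 else 0
  | N + 1, m => prodCoeff c k N m +
      if 2 * N + k ≤ m then c * prodCoeff c k N (m - (2 * N + k)) else 0

theorem coeff_prod_eq_prodCoeff (c : ℤ) (k N m : ℕ) :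
    (∏ n ∈ Finset.range N, (1 + Polynomial.C c * Polynomial.X ^ (2 * n + k) : Polynomial ℤ)).coeff
      m = prodCoeff c k N m := by
  induction N generalizing m with
  | zero => simp [prodCoeff, Polynomial.coeff_one]
  | succ N ih =>
    rw [Finset.prod_range_succ, mul_add, mul_one, Polynomial.coeff_add, ih, prodCoeff,
      mul_left_comm, Polynomial.coeff_C_mul, Polynomial.coeff_mul_X_pow']
    split_ifs with h
    · rw [ih]
    · simp

/-- The factor with index N has its nonconstant term in degree 2N + k, which exceeds m once N ≥ m.
-/
theorem prodCoeff_eq_self (c : ℤ) {k : ℕ} (hk : 0 < k) {m N : ℕ} (h : m ≤ N) :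
    prodCoeff c k N m = prodCoeff c k m m := by
  induction N, h using Nat.le_induction with
  | base => rfl
  | succ N hN ih => rw [prodCoeff, if_neg (by omega), ih, add_zero]

theorem hasProdLocallyUniformlyOn_poch (c : ℤ) (k : ℕ) {r : ℝ} (h0 : 0 ≤ r) (hr : r < 1) :
    HasProdLocallyUniformlyOn (fun (n : ℕ) (t : ℂ) => 1 + c * t ^ (2 * n + k))
      (fun t => poch (-(c * t ^ k)) (t ^ 2)) (Metric.ball 0 r) := by
  have h := Summable.hasProdLocallyUniformlyOn_nat_one_add (K := Metric.ball (0 : ℂ) r)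
    (f := fun (n : ℕ) (t : ℂ) => c * t ^ (2 * n + k)) (u := fun n => ‖(c : ℂ)‖ * r ^ n)
    Metric.isOpen_ball ?_ (.of_forall fun n x hx => ?_) (fun n => by fun_prop)
  · convert h using 2 with t
    rw [poch]
    congr 1; ext n; ring
  · exact (summable_geometric_of_lt_one h0 hr).mul_left _
  · have hx : ‖x‖ < r := by simpa using hx
    rw [norm_mul, norm_pow]
    gcongr
    calc ‖x‖ ^ (2 * n + k) ≤ ‖x‖ ^ n :=
          pow_le_pow_of_le_one (norm_nonneg _) (hx.trans hr).le (by omega)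
      _ ≤ r ^ n := by gcongr

theorem differentiableOn_poch (c : ℤ) (k : ℕ) :
    DifferentiableOn ℂ (fun t => poch (-(c * t ^ k)) (t ^ 2)) (Metric.ball 0 1) := by
  intro t ht
  obtain ⟨r, h1, h2⟩ := exists_between (show ‖t‖ < 1 by simpa using ht)
  have hd := (hasProdLocallyUniformlyOn_poch c k ((norm_nonneg t).trans h1.le)
    h2).tendstoLocallyUniformlyOn_finsetRange.differentiableOn (.of_forall fun N =>
      DifferentiableOn.fun_finsetProd fun _ _ => by fun_prop) Metric.isOpen_ball
  exact (hd.differentiableAt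
    (Metric.isOpen_ball.mem_nhds (by simpa using h1))).differentiableWithinAt

/-- Convergence on a disc of radius 1/2 suffices to identify the coefficients; validity in the whole
unit disc comes from holomorphy there. -/
theorem hasIntSeries_poch (c : ℤ) {k : ℕ} (hk : 0 < k) :
    HasIntSeries (fun m => prodCoeff c k m m) (fun t => poch (-(c * t ^ k)) (t ^ 2)) := by
  refine hasIntSeries_of_tendsto (P := fun N => ∏ n ∈ Finset.range N,
    (1 + Polynomial.C c * Polynomial.X ^ (2 * n + k))) (U := Metric.ball 0 (1 / 2))
    Metric.isOpen_ball (by simp) ?_ (differentiableOn_poch c k) ?_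
  · convert (hasProdLocallyUniformlyOn_poch c k (r := 1 / 2) (by norm_num)
      (by norm_num)).tendstoLocallyUniformlyOn_finsetRange using 3 with N t
    simp [map_prod]
  · intro m
    filter_upwards [eventually_ge_atTop m] with N hN
    rw [coeff_prod_eq_prodCoeff, prodCoeff_eq_self c hk hN]

theorem HasIntSeries.mul {A B : ℕ → ℤ} {f g : ℂ → ℂ} (hf : HasIntSeries A f)
    (hg : HasIntSeries B g) :
    HasIntSeries (fun n => ∑ i ∈ Finset.range (n + 1), A i * B (n - i)) (fun t => f t * g t) := by
  intro t ht
  have h1 := hf t ht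
  have h2 := hg t ht
  have h := hasSum_sum_range_mul_of_summable_norm h1.summable.norm h2.summable.norm
  rw [h1.tsum_eq, h2.tsum_eq] at h
  refine (congrArg (HasSum · (f t * g t)) (funext fun n => ?_)).mpr h
  push_cast
  rw [Finset.sum_mul]
  refine Finset.sum_congr rfl fun i hi => ?_
  rw [← Nat.add_sub_of_le (Nat.lt_succ_iff.1 (Finset.mem_range.1 hi)), pow_add]
  simp only [add_tsub_cancel_left]
  ring

/-! ### Computing the leading coefficients -/

/-- The truncated Cauchy product of two lists. -/
def convList (l l' : List ℤ) : List ℤ :=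
  (List.range l.length).map fun n =>
    ((List.range (n + 1)).map fun i => l.getD i 0 * l'.getD (n - i) 0).sum

/-- `f` has a power series with integer coefficients beginning with the entries of `l`. -/
def IntSeriesBegins (f : ℂ → ℂ) (l : List ℤ) : Prop :=
  ∃ A, BeginsWith A l ∧ HasIntSeries A f

theorem BeginsWith.getD {A : ℕ → ℤ} {l : List ℤ} (h : BeginsWith A l) {i : ℕ}
    (hi : i < l.length) : l.getD i 0 = A i := by
  have h' : (List.range l.length).map A = l := h
  conv_lhs => rw [← h']
  simp [hi]

theorem IntSeriesBegins.mul {f g : ℂ → ℂ} {l l' l'' : List ℤ} (hf : IntSeriesBegins f l)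
    (hg : IntSeriesBegins g l') (hl : l.length = l'.length) (h : convList l l' = l'') :
    IntSeriesBegins (fun t => f t * g t) l'' := by
  obtain ⟨A, hA, hf⟩ := hf
  obtain ⟨B, hB, hg⟩ := hg
  refine ⟨_, ?_, hf.mul hg⟩
  subst h
  have hlen : (convList l l').length = l.length := by simp [convList]
  rw [BeginsWith, hlen, convList]
  refine List.map_congr_left fun n hn => ?_
  have hn : n < l.length := List.mem_range.1 hn
  change ((List.range (n + 1)).map fun i => A i * B (n - i)).sum = _
  congr 1
  refine List.map_congr_left fun i hi => ?_
  have hi : i < n + 1 := List.mem_range.1 hi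
  -- Both indices lie below the common length of the lists, so the default value 0 of `getD` is
  -- never used.
  rw [hA.getD (by omega), hB.getD (by omega)]

theorem IntSeriesBegins.congr {f g : ℂ → ℂ} {l l' : List ℤ} (h : IntSeriesBegins f l)
    (hl : l = l') (hfg : ∀ t, f t = g t) : IntSeriesBegins g l' := by
  rwa [← funext hfg, ← hl]

/-- All series are computed to eight terms; several of the required lists are shorter. -/
theorem IntSeriesBegins.take {f : ℂ → ℂ} {l : List ℤ} (h : IntSeriesBegins f l) (k : ℕ) :
    IntSeriesBegins f (l.take k) := by
  obtain ⟨A, hA, hf⟩ := h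
  refine ⟨A, ?_, hf⟩
  have hA : (List.range l.length).map A = l := hA
  rw [BeginsWith, List.length_take]
  conv_rhs => rw [← hA]
  rw [← List.map_take, List.take_range]

theorem IntSeriesBegins.exists_coeff {f₁ f₂ : ℂ → ℂ} {l₁ l₂ : List ℤ}
    (h₁ : IntSeriesBegins f₁ l₁) (h₂ : IntSeriesBegins f₂ l₂) : ∃ A B : ℕ → ℤ,
      BeginsWith A l₁ ∧ BeginsWith B l₂ ∧ HasIntSeries A f₁ ∧ HasIntSeries B f₂ := by
  obtain ⟨A, hA, hf⟩ := h₁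
  obtain ⟨B, hB, hg⟩ := h₂
  exact ⟨A, B, hA, hB, hf, hg⟩

theorem HasIntSeries.hasCuspExpansion {A : ℕ → ℤ} {G : ℂ → ℂ} (h : HasIntSeries A G)
    {f : ℍ → ℂ} {q : ℂ → ℂ} {C : ℂ} {m : ℤ} {k : ℕ} (hk : k ≠ 0)
    (hf : ∀ τ : ℍ, ‖q τ‖ < 1 ∧ f τ = C * q τ ^ m * G (q τ ^ k)) :
    HasCuspExpansion f q C m k A := by
  intro τ
  obtain ⟨h1, h2⟩ := hf τ
  rw [h2]
  have := (h _ (norm_pow_lt_one h1 hk)).mul_left (C * q τ ^ m)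
  simpa only [pow_mul] using this

theorem intSeriesBegins_oddProd :
    IntSeriesBegins oddProd [1, -1, 0, -1, 1, -1, 1, -1] := by
  refine ⟨fun m => prodCoeff (-1) 1 m m, by rw [BeginsWith]; decide, ?_⟩
  convert hasIntSeries_poch (-1) one_pos using 2 with t
  simp [oddProd]

theorem intSeriesBegins_oddProd_neg :
    IntSeriesBegins (fun t => oddProd (-t)) [1, 1, 0, 1, 1, 1, 1, 1] := by
  refine ⟨fun m => prodCoeff 1 1 m m, by rw [BeginsWith]; decide, ?_⟩
  convert hasIntSeries_poch 1 one_pos using 2 with t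
  simp [oddProd]

theorem intSeriesBegins_evenProd :
    IntSeriesBegins evenProd [1, 0, 1, 0, 1, 0, 2, 0] := by
  refine ⟨fun m => prodCoeff 1 2 m m, by rw [BeginsWith]; decide, ?_⟩
  convert hasIntSeries_poch 1 two_pos using 2 with t
  simp [evenProd]

/-- Powers are assembled by repeated squaring; the second `rfl` evaluates the convolution of the two
integer lists. -/
theorem intSeriesBegins_oddProd_pow_2 :
    IntSeriesBegins (fun t => oddProd t ^ 2) [1, -2, 1, -2, 4, -4, 5, -6] :=
  (intSeriesBegins_oddProd.mul intSeriesBegins_oddProd rfl rfl).congr rfl fun t => by ring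

theorem intSeriesBegins_oddProd_pow_4 :
    IntSeriesBegins (fun t => oddProd t ^ 4) [1, -4, 6, -8, 17, -28, 38, -56] :=
  (intSeriesBegins_oddProd_pow_2.mul intSeriesBegins_oddProd_pow_2 rfl rfl).congr rfl fun t => by ring

theorem intSeriesBegins_oddProd_pow_8 :
    IntSeriesBegins (fun t => oddProd t ^ 8) [1, -8, 28, -64, 134, -288, 568, -1024] :=
  (intSeriesBegins_oddProd_pow_4.mul intSeriesBegins_oddProd_pow_4 rfl rfl).congr rfl fun t => by ring

theorem intSeriesBegins_oddProd_pow_9 :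
    IntSeriesBegins (fun t => oddProd t ^ 9) [1, -9, 36, -93, 207, -459, 957, -1827] :=
  (intSeriesBegins_oddProd_pow_8.mul intSeriesBegins_oddProd rfl rfl).congr rfl fun t => by ring

theorem intSeriesBegins_oddProd_neg_pow_2 :
    IntSeriesBegins (fun t => oddProd (-t) ^ 2) [1, 2, 1, 2, 4, 4, 5, 6] :=
  (intSeriesBegins_oddProd_neg.mul intSeriesBegins_oddProd_neg rfl rfl).congr rfl fun t => by ring

theorem intSeriesBegins_oddProd_neg_pow_4 :
    IntSeriesBegins (fun t => oddProd (-t) ^ 4) [1, 4, 6, 8, 17, 28, 38, 56] :=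
  (intSeriesBegins_oddProd_neg_pow_2.mul intSeriesBegins_oddProd_neg_pow_2 rfl rfl).congr rfl fun t => by ring

theorem intSeriesBegins_oddProd_neg_pow_6 :
    IntSeriesBegins (fun t => oddProd (-t) ^ 6) [1, 6, 15, 26, 51, 102, 172, 276] :=
  (intSeriesBegins_oddProd_neg_pow_4.mul intSeriesBegins_oddProd_neg_pow_2 rfl rfl).congr rfl fun t => by ring

theorem intSeriesBegins_oddProd_neg_pow_8 :
    IntSeriesBegins (fun t => oddProd (-t) ^ 8) [1, 8, 28, 64, 134, 288, 568, 1024] :=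
  (intSeriesBegins_oddProd_neg_pow_4.mul intSeriesBegins_oddProd_neg_pow_4 rfl rfl).congr rfl fun t => by ring

theorem intSeriesBegins_oddProd_neg_pow_9 :
    IntSeriesBegins (fun t => oddProd (-t) ^ 9) [1, 9, 36, 93, 207, 459, 957, 1827] :=
  (intSeriesBegins_oddProd_neg_pow_8.mul intSeriesBegins_oddProd_neg rfl rfl).congr rfl fun t => by ring

theorem intSeriesBegins_evenProd_pow_2 :
    IntSeriesBegins (fun t => evenProd t ^ 2) [1, 0, 2, 0, 3, 0, 6, 0] :=
  (intSeriesBegins_evenProd.mul intSeriesBegins_evenProd rfl rfl).congr rfl fun t => by ring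

theorem intSeriesBegins_evenProd_pow_4 :
    IntSeriesBegins (fun t => evenProd t ^ 4) [1, 0, 4, 0, 10, 0, 24, 0] :=
  (intSeriesBegins_evenProd_pow_2.mul intSeriesBegins_evenProd_pow_2 rfl rfl).congr rfl fun t => by ring

theorem intSeriesBegins_evenProd_pow_6 :
    IntSeriesBegins (fun t => evenProd t ^ 6) [1, 0, 6, 0, 21, 0, 62, 0] :=
  (intSeriesBegins_evenProd_pow_4.mul intSeriesBegins_evenProd_pow_2 rfl rfl).congr rfl fun t => by ring

theorem intSeriesBegins_evenProd_pow_8 :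
    IntSeriesBegins (fun t => evenProd t ^ 8) [1, 0, 8, 0, 36, 0, 128, 0] :=
  (intSeriesBegins_evenProd_pow_4.mul intSeriesBegins_evenProd_pow_4 rfl rfl).congr rfl fun t => by ring

theorem intSeriesBegins_evenProd_pow_9 :
    IntSeriesBegins (fun t => evenProd t ^ 9) [1, 0, 9, 0, 45, 0, 174, 0] :=
  (intSeriesBegins_evenProd_pow_8.mul intSeriesBegins_evenProd rfl rfl).congr rfl fun t => by ring

theorem intSeriesBegins_branchSeriesX :
    IntSeriesBegins branchSeriesX [1, 4, 8, 16, 32, 56, 96, 160] :=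
  intSeriesBegins_oddProd_neg_pow_4.mul intSeriesBegins_evenProd_pow_2 rfl rfl

theorem intSeriesBegins_branchSeriesY :
    IntSeriesBegins branchSeriesY [1, 6, 24, 80, 231, 606, 1480, 3408] :=
  intSeriesBegins_evenProd_pow_9.mul intSeriesBegins_oddProd_neg_pow_6 rfl rfl

theorem intSeriesBegins_poleSeriesX :
    IntSeriesBegins poleSeriesX [1, 2, -1, -2, 3, 2, -4, -4] :=
  intSeriesBegins_oddProd_neg_pow_4.mul intSeriesBegins_oddProd_pow_2 rfl rfl

theorem intSeriesBegins_poleSeriesY :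
    IntSeriesBegins poleSeriesY [1, -3, -3, 14, 6, -33, -20, 69] :=
  intSeriesBegins_oddProd_pow_9.mul intSeriesBegins_oddProd_neg_pow_6 rfl rfl

theorem intSeriesBegins_zeroSeriesX :
    IntSeriesBegins zeroSeriesX [1, 2, 5, 10, 18, 32, 55, 90] :=
  intSeriesBegins_evenProd_pow_4.mul intSeriesBegins_oddProd_neg_pow_2 rfl rfl

theorem intSeriesBegins_zeroSeriesY :
    IntSeriesBegins zeroSeriesY [1, 9, 42, 147, 444, 1206, 3017, 7092] :=
  intSeriesBegins_oddProd_neg_pow_9.mul intSeriesBegins_evenProd_pow_6 rfl rfl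

/-! ### Vanishing of q at the cusps and the assembled expansions -/

theorem vanishesAtReal_of_eq {a b c d : ℤ} {r : ℝ} (hr : (c * r + d : ℝ) = 0)
    (hdet : 0 < (a : ℝ) * d - b * c) (hc : (c : ℝ) ≠ 0) : VanishesAtReal (cuspParam a b c d) r := by
  have hpi := Real.pi_pos
  -- At r + it the denominator is cit, so the Möbius quotient equals a/c + i(ad - bc)/(c²t): a
  -- constant phase and a decaying real exponential.
  have key : ∀ t : ℝ, t ≠ 0 → (cuspParam a b c d (r + t * Complex.I)) =
      Complex.exp (Real.pi * Complex.I / 4 * (a / c)) *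
        ((Real.exp (-(Real.pi / 4 * ((a * d - b * c) / c ^ 2) * t⁻¹)) : ℝ) : ℂ) := by
    intro t ht
    have hc' : (c : ℂ) ≠ 0 := by exact_mod_cast hc
    have ht' : (t : ℂ) ≠ 0 := by exact_mod_cast ht
    have hd : (d : ℂ) = -(c * r) := by
      have : (d : ℝ) = -(c * r) := by linarith
      exact_mod_cast this
    have hI := Complex.I_ne_zero
    rw [cuspParam, Complex.ofReal_exp, ← Complex.exp_add]
    congr 1
    push_cast
    rw [hd, show (c * (r + t * Complex.I) + -(c * r) : ℂ) = c * t * Complex.I by ring]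
    field_simp
    ring_nf
  have h1 : Tendsto (fun t : ℝ => Real.exp (-(Real.pi / 4 * ((a * d - b * c) / c ^ 2) * t⁻¹)))
      (𝓝[>] 0) (𝓝 0) := by
    refine Real.tendsto_exp_neg_atTop_nhds_zero.comp ?_
    refine tendsto_inv_nhdsGT_zero.const_mul_atTop ?_
    have : 0 < (c : ℝ) ^ 2 := by positivity
    positivity
  have h2 : Tendsto (fun t : ℝ => Complex.exp (Real.pi * Complex.I / 4 * (a / c)) *
      ((Real.exp (-(Real.pi / 4 * ((a * d - b * c) / c ^ 2) * t⁻¹)) : ℝ) : ℂ)) (𝓝[>] 0) (𝓝 0) := by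
    have := (Complex.continuous_ofReal.tendsto 0).comp h1
    simpa using this.const_mul (Complex.exp (Real.pi * Complex.I / 4 * (a / c)))
  refine h2.congr' ?_
  filter_upwards [self_mem_nhdsWithin] with t ht
  exact (key t (ne_of_gt ht)).symm

theorem vanishesAtInfty_cuspParam (b : ℤ) : VanishesAtInfty (cuspParam 1 b 0 1) := by
  have hpi := Real.pi_pos
  have h1 : Tendsto (fun t : ℝ => Real.exp (-(Real.pi / 4 * t))) atTop (𝓝 0) :=
    Real.tendsto_exp_neg_atTop_nhds_zero.comp (tendsto_id.const_mul_atTop (by positivity))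
  have h2 : Tendsto (fun t : ℝ => Complex.exp (Real.pi * Complex.I / 4 * b) *
      ((Real.exp (-(Real.pi / 4 * t)) : ℝ) : ℂ)) atTop (𝓝 0) := by
    have := (Complex.continuous_ofReal.tendsto 0).comp h1
    simpa using this.const_mul (Complex.exp (Real.pi * Complex.I / 4 * b))
  refine h2.congr fun t => ?_
  rw [cuspParam, Complex.ofReal_exp, ← Complex.exp_add]
  congr 1
  push_cast
  ring_nf
  simp only [Complex.I_sq]
  ring

theorem omega48_pow_eq_exp (n : ℕ) : omega48 ^ n = Complex.exp (n / 24 * Real.pi * Complex.I) := by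
  rw [omega48_pow]; congr 1; ring

theorem pole_expansions : VanishesAtReal (cuspParam 2 (-5) 1 (-2)) 2 ∧ ∃ A B : ℕ → ℤ,
    BeginsWith A [1, 2, -1, -2, 3, 2, -4, -4] ∧ BeginsWith B [1, -3, -3, 14, 6, -33, -20] ∧
    HasCuspExpansion burnsideX (cuspParam 2 (-5) 1 (-2)) (1 / 2) (-2) 8 A ∧
    HasCuspExpansion burnsideY (cuspParam 2 (-5) 1 (-2)) ((√2 : ℝ) / 8) (-5) 8 B := by
  refine ⟨vanishesAtReal_of_eq (by norm_num) (by norm_num) (by norm_num), ?_⟩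
  obtain ⟨A, B, hA, hB, hX, hY⟩ :=
    intSeriesBegins_poleSeriesX.exists_coeff (intSeriesBegins_poleSeriesY.take 7)
  exact ⟨A, B, hA, hB,
    hX.hasCuspExpansion (by norm_num) fun τ => ⟨(expansion_two τ).1, (expansion_two τ).2.1⟩,
    hY.hasCuspExpansion (by norm_num) fun τ => ⟨(expansion_two τ).1, (expansion_two τ).2.2⟩⟩

theorem zero_expansions : VanishesAtReal (cuspParam 1 (-2) 2 0) 0 ∧ ∃ A B : ℕ → ℤ,
    BeginsWith A [1, 2, 5, 10, 18, 32] ∧ BeginsWith B [1, 9, 42, 147, 444, 1206] ∧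
    HasCuspExpansion burnsideX (cuspParam 1 (-2) 2 0)
      (2 * Complex.exp (3 / 4 * Real.pi * Complex.I)) 2 8 A ∧
    HasCuspExpansion burnsideY (cuspParam 1 (-2) 2 0)
      (-Complex.exp (-(1 / 8) * Real.pi * Complex.I) * (√2 : ℝ)) 1 8 B := by
  refine ⟨vanishesAtReal_of_eq (by norm_num) (by norm_num) (by norm_num), ?_⟩
  obtain ⟨A, B, hA, hB, hX, hY⟩ :=
    (intSeriesBegins_zeroSeriesX.take 6).exists_coeff (intSeriesBegins_zeroSeriesY.take 6)
  have e1 : Complex.exp (3 / 4 * Real.pi * Complex.I) = omega48 ^ 18 := by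
    rw [omega48_pow_eq_exp]; congr 1; push_cast; ring
  have e2 : Complex.exp (-(1 / 8) * Real.pi * Complex.I) = (omega48 ^ 3)⁻¹ := by
    rw [omega48_pow_eq_exp, ← Complex.exp_neg]; congr 1; push_cast; ring
  rw [e1, e2]
  exact ⟨A, B, hA, hB,
    hX.hasCuspExpansion (by norm_num) fun τ => ⟨(expansion_zero τ).1, (expansion_zero τ).2.1⟩,
    hY.hasCuspExpansion (by norm_num) fun τ => ⟨(expansion_zero τ).1, (expansion_zero τ).2.2⟩⟩

theorem branch_expansions : VanishesAtReal (cuspParam 3 (-2) 2 (-1)) (1 / 2) ∧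
    VanishesAtInfty (cuspParam 1 (-2) 0 1) ∧ VanishesAtReal (cuspParam 1 (-2) 1 (-1)) 1 ∧
    VanishesAtReal (cuspParam (-1) (-2) 1 1) (-1) ∧ ∃ A B : ℕ → ℤ,
    BeginsWith A [1, 4, 8, 16, 32, 56, 96] ∧ BeginsWith B [1, 6, 24, 80, 231, 606] ∧
    HasCuspExpansion burnsideX (cuspParam 3 (-2) 2 (-1)) 1 0 2 A ∧
    HasCuspExpansion burnsideY (cuspParam 3 (-2) 2 (-1)) 4 1 2 B ∧
    HasCuspExpansion burnsideX (cuspParam 1 (-2) 0 1) (-1) 0 2 A ∧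
    HasCuspExpansion burnsideY (cuspParam 1 (-2) 0 1) (-4 * Complex.I) 1 2 B ∧
    HasCuspExpansion burnsideX (cuspParam 1 (-2) 1 (-1)) Complex.I 0 2 A ∧
    HasCuspExpansion burnsideY (cuspParam 1 (-2) 1 (-1))
      (4 * Complex.exp (Real.pi * Complex.I / 4)) 1 2 B ∧
    HasCuspExpansion burnsideX (cuspParam (-1) (-2) 1 1) (-Complex.I) 0 2 A ∧
    HasCuspExpansion burnsideY (cuspParam (-1) (-2) 1 1)
      (4 * Complex.exp (-(Real.pi * Complex.I / 4))) 1 2 B := by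
  refine ⟨vanishesAtReal_of_eq (by norm_num) (by norm_num) (by norm_num),
    vanishesAtInfty_cuspParam _,
    vanishesAtReal_of_eq (by norm_num) (by norm_num) (by norm_num),
    vanishesAtReal_of_eq (by norm_num) (by norm_num) (by norm_num), ?_⟩
  obtain ⟨A, B, hA, hB, hX, hY⟩ :=
    (intSeriesBegins_branchSeriesX.take 7).exists_coeff (intSeriesBegins_branchSeriesY.take 6)
  have e1 : Complex.exp (Real.pi * Complex.I / 4) = omega48 ^ 6 := by
    rw [omega48_pow_eq_exp]; congr 1; push_cast; ring
  have h2 : (2 : ℕ) ≠ 0 := two_ne_zero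
  rw [Complex.exp_neg, e1, show (-4 * Complex.I : ℂ) = 4 * -Complex.I by ring,
    show (4 : ℂ) = 4 * 1 by ring]
  refine ⟨A, B, hA, hB,
    hX.hasCuspExpansion h2 fun τ => ⟨(expansion_half τ).1, (expansion_half τ).2.1⟩,
    hY.hasCuspExpansion h2 fun τ => ⟨(expansion_half τ).1, (expansion_half τ).2.2⟩,
    hX.hasCuspExpansion h2 fun τ => ⟨(expansion_infty τ).1, (expansion_infty τ).2.1⟩,
    hY.hasCuspExpansion h2 fun τ => ⟨(expansion_infty τ).1, ?_⟩,
    hX.hasCuspExpansion h2 fun τ => ⟨(expansion_one τ).1, (expansion_one τ).2.1⟩,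
    hY.hasCuspExpansion h2 fun τ => ⟨(expansion_one τ).1, ?_⟩,
    hX.hasCuspExpansion h2 fun τ => ⟨(expansion_neg_one τ).1, (expansion_neg_one τ).2.1⟩,
    hY.hasCuspExpansion h2 fun τ => ⟨(expansion_neg_one τ).1, ?_⟩⟩
  · rw [(expansion_infty τ).2.2, mul_one]
  · rw [(expansion_one τ).2.2, mul_one]
  · rw [(expansion_neg_one τ).2.2, mul_one]

/-! ### Holomorphy and nonconstancy -/

theorem differentiableOn_oddProd : DifferentiableOn ℂ oddProd (Metric.ball 0 1) := by
  convert differentiableOn_poch (-1) 1 using 2 with t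
  simp [oddProd]

theorem norm_expQuarter_lt_one {z : ℂ} (hz : 0 < z.im) : ‖expQuarter z‖ < 1 := by
  simpa [expQuarter] using norm_exp_mul_lt_one two_pos hz

/-- The extension of Burnside's function `x` by its product formula. -/
def xFun (z : ℂ) : ℂ := -(oddProd (expQuarter z) / oddProd (-expQuarter z)) ^ 2

/-- The extension of Burnside's function `y` by its product formula. -/
def yFun (z : ℂ) : ℂ :=
  -4 * expQuarter (z / 2) / (oddProd (expQuarter z) ^ 3 * oddProd (-expQuarter z) ^ 9)

theorem burnsideX_eq_xFun (τ : ℍ) : burnsideX τ = xFun τ := by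
  rw [burnsideX_eq, xFun, expQuarter_self]

theorem burnsideY_eq_yFun (τ : ℍ) : burnsideY τ = yFun τ := by
  rw [burnsideY_eq, yFun, expQuarter_self]; rfl

theorem oddProd_expQuarter {z : ℂ} (hz : 0 < z.im) :
    DifferentiableAt ℂ (fun z => oddProd (expQuarter z)) z ∧
    DifferentiableAt ℂ (fun z => oddProd (-expQuarter z)) z ∧
    oddProd (expQuarter z) ≠ 0 ∧ oddProd (-expQuarter z) ≠ 0 := by
  have h := norm_expQuarter_lt_one hz
  have h' : ‖-expQuarter z‖ < 1 := by rwa [norm_neg]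
  have hd : ∀ {t : ℂ}, ‖t‖ < 1 → DifferentiableAt ℂ oddProd t := fun ht =>
    differentiableOn_oddProd.differentiableAt (Metric.isOpen_ball.mem_nhds (by simpa using ht))
  exact ⟨DifferentiableAt.comp z (hd h) (differentiable_expQuarter z),
    DifferentiableAt.comp z (f := fun z => -expQuarter z) (hd h') (differentiable_expQuarter z).neg, oddProd_ne_zero h, oddProd_ne_zero h'⟩

theorem differentiableOn_xFun : DifferentiableOn ℂ xFun {z | 0 < z.im} := by
  intro z hz
  obtain ⟨h1, h2, -, h4⟩ := oddProd_expQuarter hz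
  exact ((h1.div h2 h4).pow 2).neg.differentiableWithinAt

theorem differentiableOn_yFun : DifferentiableOn ℂ yFun {z | 0 < z.im} := by
  intro z hz
  obtain ⟨h1, h2, h3, h4⟩ := oddProd_expQuarter hz
  have h5 : DifferentiableAt ℂ (fun z => expQuarter (z / 2)) z :=
    (differentiable_expQuarter.comp (differentiable_id.div_const 2)) z
  exact ((h5.const_mul (-4)).div ((h1.pow 3).mul (h2.pow 9))
    (mul_ne_zero (pow_ne_zero 3 h3) (pow_ne_zero 9 h4))).differentiableWithinAt

theorem mdifferentiable_of_differentiableOn {f : ℍ → ℂ} {g : ℂ → ℂ} (h : ∀ τ : ℍ, f τ = g τ)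
    (hg : DifferentiableOn ℂ g {z | 0 < z.im}) : MDifferentiable 𝓘(ℂ) 𝓘(ℂ) f := by
  rw [UpperHalfPlane.mdifferentiable_iff]
  refine hg.congr fun z hz => ?_
  rw [Function.comp_apply, h, UpperHalfPlane.ofComplex_apply_of_im_pos hz]

theorem mdifferentiable_burnsideX : MDifferentiable 𝓘(ℂ) 𝓘(ℂ) burnsideX :=
  mdifferentiable_of_differentiableOn burnsideX_eq_xFun differentiableOn_xFun

theorem mdifferentiable_burnsideY : MDifferentiable 𝓘(ℂ) 𝓘(ℂ) burnsideY :=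
  mdifferentiable_of_differentiableOn burnsideY_eq_yFun differentiableOn_yFun

/-- No factor of the product formula vanishes. By the curve equation x omits 0, ±1 and ±i, which is
why these values are seen only at cusps; it also permits division by y. -/
theorem burnsideY_ne_zero (τ : ℍ) : burnsideY τ ≠ 0 := by
  obtain ⟨-, -, h3, h4⟩ := oddProd_expQuarter τ.im_pos
  rw [burnsideY_eq_yFun, yFun]
  have := expQuarter_ne_zero (τ / 2)
  simp [h3, h4, this]

/-- The shift by 2 changes the sign of `expQuarter z`, which swaps the numerator and denominator
products. -/
theorem xFun_mul_xFun_add_two {z : ℂ} (hz : 0 < z.im) : xFun z * xFun (z + 2) = 1 := by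
  obtain ⟨-, -, h3, h4⟩ := oddProd_expQuarter hz
  rw [xFun, xFun, expQuarter_add, expQuarter_two, mul_neg_one, neg_neg]
  field_simp

theorem eventually_xFun_ne (c : ℂ) {z₀ : ℂ} (hz₀ : 0 < z₀.im) : ∀ᶠ z in 𝓝[≠] z₀, xFun z ≠ c := by
  have hopen : IsOpen {z : ℂ | 0 < z.im} := isOpen_lt continuous_const Complex.continuous_im
  have hconn : IsPreconnected {z : ℂ | 0 < z.im} := (convex_halfSpace_im_gt 0).isPreconnected
  have han : AnalyticOnNhd ℂ (fun z => xFun z - c) {z | 0 < z.im} :=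
    (differentiableOn_xFun.sub_const c).analyticOnNhd hopen
  rcases (han z₀ hz₀).eventually_eq_zero_or_eventually_ne_zero with h | h
  · exfalso
    have h0 := han.eqOn_zero_of_preconnected_of_eventuallyEq_zero hconn hz₀ h
    have h1 : ∀ z : ℂ, 0 < z.im → xFun z = c := fun z hz => sub_eq_zero.1 (h0 hz)
    have hI : 0 < Complex.I.im := by simp
    -- A constant value c would satisfy c² = 1, so c⁵ - c = 0, against the nonvanishing of y.
    have h2 := xFun_mul_xFun_add_two hI
    rw [h1 _ hI, h1 _ (by simp)] at h2
    have h3 := burnsideY_sq UpperHalfPlane.I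
    rw [burnsideX_eq_xFun, h1 _ UpperHalfPlane.I.im_pos] at h3
    refine burnsideY_ne_zero UpperHalfPlane.I (pow_eq_zero_iff two_ne_zero |>.1 ?_)
    rw [h3]
    linear_combination (c ^ 3 + c) * h2
  · filter_upwards [h] with z hz
    exact sub_ne_zero.1 hz

theorem eventually_codiscrete_burnsideX_ne (c : ℂ) : ∀ᶠ τ in codiscrete ℍ, burnsideX τ ≠ c := by
  rw [Filter.Eventually, mem_codiscrete]
  intro τ₀
  rw [Filter.disjoint_principal_right, compl_compl]
  have h : Tendsto (fun τ : ℍ => (τ : ℂ)) (𝓝[≠] τ₀) (𝓝[≠] (τ₀ : ℂ)) := by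
    refine tendsto_nhdsWithin_iff.2 ⟨(UpperHalfPlane.continuous_coe.tendsto τ₀).mono_left
      nhdsWithin_le_nhds, ?_⟩
    filter_upwards [self_mem_nhdsWithin] with τ hτ h
    exact hτ (UpperHalfPlane.ext h)
  filter_upwards [h.eventually (eventually_xFun_ne c τ₀.im_pos)] with τ hτ
  rwa [burnsideX_eq_xFun]

theorem eventually_codiscrete_burnsideX_notMem {S : Set ℂ} (hS : S.Finite) :
    ∀ᶠ τ in codiscrete ℍ, burnsideX τ ∉ S := by
  have := (eventually_all_finite hS).2 fun c _ => eventually_codiscrete_burnsideX_ne c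
  filter_upwards [this] with τ hτ h
  exact hτ _ h rfl

/-- Makes the ring of germs nontrivial, so that a ring homomorphism from the field of rational
functions into it is injective. -/
instance codiscrete_upperHalfPlane_neBot : (codiscrete ℍ).NeBot := by
  rw [neBot_iff]
  intro h
  have h1 : (∅ : Set ℍ) ∈ codiscrete ℍ := by rw [h]; exact mem_bot
  rw [mem_codiscrete] at h1
  have h2 := h1 UpperHalfPlane.I
  simp only [Set.compl_empty, principal_univ, disjoint_top] at h2
  have h3 := UpperHalfPlane.isOpenEmbedding_coe.isOpenMap _
    (isOpen_singleton_iff_punctured_nhds _ |>.2 h2)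
  rw [Set.image_singleton] at h3
  exact not_isOpen_singleton _ h3

theorem toGerm_eq_iff {f g : ℍ → ℂ} : toGerm f = toGerm g ↔ f =ᶠ[codiscrete ℍ] g :=
  Filter.Germ.coe_eq

/-! ### The field of functions R₁(x) + y R₂(x) -/

/-- The polynomial `X⁵ - X`. -/
def curvePoly : Polynomial ℂ := Polynomial.X ^ 5 - Polynomial.X

theorem natDegree_curvePoly : curvePoly.natDegree = 5 := by
  unfold curvePoly; compute_degree!

theorem curvePoly_ne_zero : curvePoly ≠ 0 := by
  intro h
  have := natDegree_curvePoly
  rw [h] at this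
  simp at this

theorem eventually_denom_ne_zero (R : RatFunc ℂ) :
    ∀ᶠ τ in codiscrete ℍ, Polynomial.eval₂ (RingHom.id ℂ) (burnsideX τ) R.denom ≠ 0 := by
  filter_upwards [eventually_codiscrete_burnsideX_notMem
    (R.denom.rootSet_finite ℂ)] with τ hτ h
  refine hτ ((Polynomial.mem_rootSet).2 ⟨R.denom_ne_zero, ?_⟩)
  rwa [Polynomial.aeval_def, Algebra.algebraMap_self]

/-- The class of `τ ↦ R (x(τ))`, as a function of the rational function `R`. -/
def evalGerm : RatFunc ℂ →+* FunctionGerms where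
  toFun R := toGerm fun τ => R.eval (RingHom.id ℂ) (burnsideX τ)
  map_one' := by simp only [RatFunc.eval_one]; rfl
  map_zero' := by simp only [RatFunc.eval_zero]; rfl
  -- `RatFunc.eval` respects sums and products only away from zeros of the denominators, which x
  -- meets only on a discrete set.
  map_add' R S := by
    refine toGerm_eq_iff.2 ?_
    filter_upwards [eventually_denom_ne_zero R, eventually_denom_ne_zero S] with τ h1 h2
    exact RatFunc.eval_add _ _ h1 h2
  map_mul' R S := by
    refine toGerm_eq_iff.2 ?_
    filter_upwards [eventually_denom_ne_zero R, eventually_denom_ne_zero S] with τ h1 h2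
    exact RatFunc.eval_mul _ _ h1 h2

theorem evalGerm_apply (R : RatFunc ℂ) :
    evalGerm R = toGerm fun τ => R.eval (RingHom.id ℂ) (burnsideX τ) := rfl

theorem evalGerm_C (c : ℂ) : evalGerm (RatFunc.C c) = toGerm fun _ => c := by
  simp only [evalGerm_apply, RatFunc.eval_C, RingHom.id_apply]

theorem evalGerm_X : evalGerm RatFunc.X = toGerm burnsideX := by
  simp only [evalGerm_apply, RatFunc.eval_X]

theorem evalGerm_injective : Function.Injective evalGerm := RingHom.injective _

theorem toGerm_rationalInXY (R₁ R₂ : RatFunc ℂ) :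
    toGerm (rationalInXY R₁ R₂) = evalGerm R₁ + toGerm burnsideY * evalGerm R₂ := rfl

theorem toGerm_burnsideY_sq :
    toGerm burnsideY ^ 2 = evalGerm (algebraMap _ (RatFunc ℂ) curvePoly) := by
  have h : ((fun τ => burnsideY τ ^ 2) : ℍ → ℂ) = fun τ =>
      (algebraMap (Polynomial ℂ) (RatFunc ℂ) curvePoly).eval (RingHom.id ℂ) (burnsideX τ) := by
    funext τ
    rw [burnsideY_sq, RatFunc.eval_algebraMap, curvePoly]
    simp
  rw [evalGerm_apply, ← h]
  rfl

/-- Parity of degrees: a nonzero R₁² has even degree and a nonzero R₂²(X⁵ - X) odd degree. -/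
theorem sq_sub_sq_mul_curvePoly_ne_zero {R₁ R₂ : RatFunc ℂ} (h : R₁ ≠ 0 ∨ R₂ ≠ 0) :
    R₁ ^ 2 - R₂ ^ 2 * algebraMap _ (RatFunc ℂ) curvePoly ≠ 0 := by
  intro h0
  have hc : algebraMap _ (RatFunc ℂ) curvePoly ≠ 0 :=
    RatFunc.algebraMap_ne_zero curvePoly_ne_zero
  rw [sub_eq_zero] at h0
  by_cases h2 : R₂ = 0
  · subst h2
    simp at h0
    simp [h0] at h
  have h1 : R₁ ≠ 0 := by
    rintro rfl
    have := mul_ne_zero (pow_ne_zero 2 h2) hc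
    rw [← h0] at this
    simp at this
  have := congrArg RatFunc.intDegree h0
  rw [RatFunc.intDegree_mul (pow_ne_zero 2 h2) hc, pow_two, pow_two, RatFunc.intDegree_mul h1 h1,
    RatFunc.intDegree_mul h2 h2, RatFunc.intDegree_polynomial, natDegree_curvePoly] at this
  omega

/-- Multiplying by the conjugate gives the norm R₁² - R₂²(X⁵ - X), which must then vanish. -/
theorem evalGerm_add_mul_eq_zero {R₁ R₂ : RatFunc ℂ}
    (h : evalGerm R₁ + toGerm burnsideY * evalGerm R₂ = 0) : R₁ = 0 ∧ R₂ = 0 := by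
  by_contra hne
  refine sq_sub_sq_mul_curvePoly_ne_zero (R₁ := R₁) (R₂ := R₂) (by tauto) ?_
  refine evalGerm_injective ?_
  rw [map_sub, map_mul, map_pow, map_pow, ← toGerm_burnsideY_sq, map_zero]
  linear_combination (evalGerm R₁ - toGerm burnsideY * evalGerm R₂) * h

/-- The ring of the functions `R₁(x) + y R₂(x)` on the upper half-plane. -/
def functionSubring : Subring FunctionGerms where
  carrier := {g | ∃ R₁ R₂, g = evalGerm R₁ + toGerm burnsideY * evalGerm R₂}
  mul_mem' := by
    rintro _ _ ⟨R₁, R₂, rfl⟩ ⟨S₁, S₂, rfl⟩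
    refine ⟨R₁ * S₁ + R₂ * S₂ * algebraMap _ (RatFunc ℂ) curvePoly, R₁ * S₂ + R₂ * S₁, ?_⟩
    simp only [map_add, map_mul, ← toGerm_burnsideY_sq]
    ring
  one_mem' := ⟨1, 0, by simp⟩
  add_mem' := by
    rintro _ _ ⟨R₁, R₂, rfl⟩ ⟨S₁, S₂, rfl⟩
    refine ⟨R₁ + S₁, R₂ + S₂, ?_⟩
    simp only [map_add]
    ring
  zero_mem' := ⟨0, 0, by simp⟩
  neg_mem' := by
    rintro _ ⟨R₁, R₂, rfl⟩
    refine ⟨-R₁, -R₂, ?_⟩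
    simp only [map_neg]
    ring

/-- The inverse is the conjugate R₁ - yR₂ divided by the norm, a nonzero rational function of x. -/
theorem isField_functionSubring : IsField functionSubring where
  exists_pair_ne := ⟨0, 1, zero_ne_one⟩
  mul_comm := mul_comm
  mul_inv_cancel := by
    rintro ⟨_, R₁, R₂, rfl⟩ hne
    have h : R₁ ≠ 0 ∨ R₂ ≠ 0 := by
      by_contra! h
      refine hne (Subtype.ext ?_)
      simp [h.1, h.2]
    have hN := sq_sub_sq_mul_curvePoly_ne_zero h
    set N := R₁ ^ 2 - R₂ ^ 2 * algebraMap _ (RatFunc ℂ) curvePoly with hNdef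
    have h1 : evalGerm N * evalGerm N⁻¹ = 1 := by rw [← map_mul, mul_inv_cancel₀ hN, map_one]
    refine ⟨⟨_, R₁ * N⁻¹, -(R₂ * N⁻¹), rfl⟩, Subtype.ext ?_⟩
    rw [hNdef, map_sub, map_mul, map_pow, map_pow, ← toGerm_burnsideY_sq, ← hNdef] at h1
    simp only [Subring.coe_mul, Subring.coe_one, map_mul, map_neg]
    linear_combination h1

/-- Polynomials in x are built by ring operations. An inverse of the denominator inside `L` is an
inverse among germs, so rational functions of x follow. -/
theorem functionSubring_le {L : Subring FunctionGerms} (hL : IsField L)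
    (hC : ∀ c : ℂ, toGerm (fun _ => c) ∈ L) (hX : toGerm burnsideX ∈ L)
    (hY : toGerm burnsideY ∈ L) : functionSubring ≤ L := by
  have hpoly : ∀ p : Polynomial ℂ, evalGerm (algebraMap _ (RatFunc ℂ) p) ∈ L := by
    intro p
    induction p using Polynomial.induction_on' with
    | add p q hp hq => rw [map_add, map_add]; exact L.add_mem hp hq
    | monomial n c =>
      rw [← Polynomial.C_mul_X_pow_eq_monomial, map_mul, map_mul, map_pow, map_pow,
        RatFunc.algebraMap_C, RatFunc.algebraMap_X, evalGerm_C, evalGerm_X]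
      exact L.mul_mem (hC c) (L.pow_mem hX n)
  have hrat : ∀ R : RatFunc ℂ, evalGerm R ∈ L := by
    intro R
    have hd : algebraMap _ (RatFunc ℂ) R.denom ≠ 0 :=
      RatFunc.algebraMap_ne_zero R.denom_ne_zero
    have hd' : evalGerm (algebraMap _ (RatFunc ℂ) R.denom) ≠ 0 :=
      (map_ne_zero_iff _ evalGerm_injective).2 hd
    obtain ⟨⟨b, hbL⟩, hb⟩ := hL.mul_inv_cancel
      (a := ⟨_, hpoly R.denom⟩) (fun h => hd' (congrArg Subtype.val h))
    have hb' : evalGerm (algebraMap _ (RatFunc ℂ) R.denom) * b = 1 := congrArg Subtype.val hb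
    have hR : evalGerm R * evalGerm (algebraMap _ (RatFunc ℂ) R.denom) =
        evalGerm (algebraMap _ (RatFunc ℂ) R.num) := by
      rw [← map_mul]
      congr 1
      exact (div_eq_iff hd).1 (RatFunc.num_div_denom R) |>.symm
    have : evalGerm R = evalGerm (algebraMap _ (RatFunc ℂ) R.num) * b := by
      linear_combination b * hR - evalGerm R * hb'
    rw [this]
    exact L.mul_mem (hpoly _) hbL
  rintro _ ⟨R₁, R₂, rfl⟩
  exact L.add_mem (hrat _) (L.mul_mem hY (hrat _))

theorem existsUnique_rationalInXY {g : FunctionGerms} (hg : g ∈ functionSubring) :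
    ∃! R : RatFunc ℂ × RatFunc ℂ, g = toGerm (rationalInXY R.1 R.2) := by
  obtain ⟨R₁, R₂, rfl⟩ := hg
  refine ⟨(R₁, R₂), rfl, ?_⟩
  rintro ⟨S₁, S₂⟩ h
  simp only [toGerm_rationalInXY] at h
  obtain ⟨h1, h2⟩ := evalGerm_add_mul_eq_zero (R₁ := S₁ - R₁) (R₂ := S₂ - R₂) (by
    rw [map_sub, map_sub]
    linear_combination -h)
  rw [sub_eq_zero] at h1 h2
  rw [h1, h2]

/-! ### Meromorphic functions on the sphere are rational -/

theorem eventually_codiscrete_iff {X : Type*} [TopologicalSpace X] {P : X → Prop} :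
    (∀ᶠ x in codiscrete X, P x) ↔ ∀ x, ∀ᶠ y in 𝓝[≠] x, P y := by
  simp only [Filter.Eventually, mem_codiscrete, disjoint_principal_right, compl_compl]

theorem MeromorphicAt.polynomial_eval {u : ℂ → ℂ} {x : ℂ} (hu : MeromorphicAt u x)
    (p : Polynomial ℂ) : MeromorphicAt (fun s => p.eval (u s)) x := by
  induction p using Polynomial.induction_on' with
  | add p q hp hq => simpa using hp.fun_add hq
  | monomial n c => simpa using (MeromorphicAt.const c x).fun_mul (hu.fun_pow n)

theorem MeromorphicAt.ratFunc_eval {u : ℂ → ℂ} {x : ℂ} (hu : MeromorphicAt u x)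
    (R : RatFunc ℂ) : MeromorphicAt (fun s => R.eval (RingHom.id ℂ) (u s)) x :=
  (hu.polynomial_eval R.num).fun_div (hu.polynomial_eval R.denom)

/-- Passing to the divided difference at the origin lowers the growth exponent by one. For exponent
zero, the divided difference is entire and tends to zero at infinity, so it vanishes. -/
theorem exists_polynomial_of_growth {n : ℕ} {f : ℂ → ℂ} (hf : Differentiable ℂ f) {C : ℝ}
    (hC : ∀ᶠ u in Bornology.cobounded ℂ, ‖f u‖ ≤ C * ‖u‖ ^ n) :
    ∃ p : Polynomial ℂ, ∀ u, f u = p.eval u := by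
  have hd {f : ℂ → ℂ} (hf : Differentiable ℂ f) : Differentiable ℂ (dslope f 0) := by
    rw [← differentiableOn_univ] at hf ⊢
    exact (Complex.differentiableOn_dslope univ_mem).2 hf
  have hbig : ∀ᶠ u : ℂ in Bornology.cobounded ℂ, 1 ≤ ‖u‖ :=
    tendsto_norm_cobounded_atTop.eventually_ge_atTop 1
  have hnorm {f : ℂ → ℂ} {u : ℂ} (hu : 1 ≤ ‖u‖) :
      ‖dslope f 0 u‖ ≤ (‖f u‖ + ‖f 0‖) / ‖u‖ := by
    have hu0 : u ≠ 0 := norm_pos_iff.1 (by linarith)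
    rw [dslope_of_ne _ hu0, slope_def_field, norm_div, sub_zero]
    gcongr
    exact norm_sub_le _ _
  have hrec (f : ℂ → ℂ) (u : ℂ) : f u = f 0 + u * dslope f 0 u := by
    have := sub_smul_dslope f 0 u
    rw [sub_zero, smul_eq_mul] at this
    rw [this]; ring
  induction n generalizing f C with
  | zero =>
    have ht : Tendsto (dslope f 0) (Bornology.cobounded ℂ) (𝓝 0) := by
      have h1 : Tendsto (fun u : ℂ => (C + ‖f 0‖) / ‖u‖) (Bornology.cobounded ℂ) (𝓝 0) :=
        tendsto_const_nhds.div_atTop tendsto_norm_cobounded_atTop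
      refine squeeze_zero_norm' ?_ h1
      filter_upwards [hbig, hC] with u hu h
      refine (hnorm hu).trans ?_
      rw [pow_zero, mul_one] at h
      gcongr
    rw [Metric.cobounded_eq_cocompact] at ht
    have h0 := (hd hf).eq_const_of_tendsto_cocompact ht
    refine ⟨Polynomial.C (f 0), fun u => ?_⟩
    rw [hrec f u, h0]
    simp
  | succ n ih =>
    obtain ⟨p, hp⟩ := ih (hd hf) (C := C + ‖f 0‖) (by
      filter_upwards [hbig, hC] with u hu h
      refine (hnorm hu).trans ?_
      rw [div_le_iff₀ (by linarith)]
      have h1 : 1 ≤ ‖u‖ ^ (n + 1) := one_le_pow₀ hu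
      calc ‖f u‖ + ‖f 0‖ ≤ C * ‖u‖ ^ (n + 1) + ‖f 0‖ * ‖u‖ ^ (n + 1) :=
            add_le_add h (le_mul_of_one_le_right (norm_nonneg _) h1)
        _ = _ := by ring)
    refine ⟨Polynomial.C (f 0) + Polynomial.X * p, fun u => ?_⟩
    rw [hrec f u, hp]
    simp

/-- Near each point a power of u - z clears the only possible pole; compactness leaves finitely many
such powers to multiply. -/
theorem exists_polynomial_mul_order_nonneg {G : ℂ → ℂ} (hG : ∀ z, MeromorphicAt G z) {s : Set ℂ}
    (hs : IsCompact s) : ∃ p : Polynomial ℂ, p ≠ 0 ∧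
      ∀ z ∈ s, 0 ≤ meromorphicOrderAt (fun u => p.eval u * G u) z := by
  have hp (p : Polynomial ℂ) (z : ℂ) : AnalyticAt ℂ (fun u => p.eval u) z :=
    AnalyticOnNhd.eval_polynomial p z trivial
  have hmul (p q : Polynomial ℂ) {z : ℂ} (h : 0 ≤ meromorphicOrderAt (fun u => p.eval u * G u) z) :
      0 ≤ meromorphicOrderAt (fun u => (q * p).eval u * G u) z := by
    have : (fun u => (q * p).eval u * G u) =
        (fun u => q.eval u) * fun u => p.eval u * G u := by
      funext u; simp [mul_assoc]
    rw [this, meromorphicOrderAt_mul (hp q z).meromorphicAt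
      ((hp p z).meromorphicAt.fun_mul (hG z))]
    exact add_nonneg (hp q z).meromorphicOrderAt_nonneg h
  refine hs.induction_on (p := fun s => ∃ p : Polynomial ℂ, p ≠ 0 ∧
    ∀ z ∈ s, 0 ≤ meromorphicOrderAt (fun u => p.eval u * G u) z) ?_ ?_ ?_ ?_
  · exact ⟨1, one_ne_zero, by simp⟩
  · rintro s t hst ⟨p, h0, h⟩
    exact ⟨p, h0, fun z hz => h z (hst hz)⟩
  · rintro s t ⟨p, hp0, h1⟩ ⟨q, hq0, h2⟩
    refine ⟨q * p, mul_ne_zero hq0 hp0, fun z hz => hz.elim (fun h => hmul p q (h1 z h)) fun h => ?_⟩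
    rw [mul_comm q p]
    exact hmul q p (h2 z h)
  · intro z hz
    obtain ⟨n, hn⟩ := hG z
    refine ⟨_, mem_nhdsWithin_of_mem_nhds hn.eventually_analyticAt, (Polynomial.X - Polynomial.C z) ^ n,
      pow_ne_zero n (Polynomial.X_sub_C_ne_zero z), fun w hw => ?_⟩
    have hw' : AnalyticAt ℂ (fun u => (u - z) ^ n • G u) w := hw
    have : (fun u => ((Polynomial.X - Polynomial.C z) ^ n).eval u * G u) =
        fun u => (u - z) ^ n • G u := by
      funext u; simp
    rw [this]
    exact hw'.meromorphicOrderAt_nonneg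

/-- A function that is meromorphic on the Riemann sphere is rational. -/
theorem exists_ratFunc_of_meromorphic {G : ℂ → ℂ} (hG : ∀ z, MeromorphicAt G z)
    (hinf : MeromorphicAt (fun w => G w⁻¹) 0) :
    ∃ R : RatFunc ℂ, G =ᶠ[codiscrete ℂ] fun u => R.eval (RingHom.id ℂ) u := by
  -- Meromorphy at infinity gives analyticity near infinity, so all poles lie in one closed disc.
  have hana : ∀ᶠ u in Bornology.cobounded ℂ, AnalyticAt ℂ G u := by
    filter_upwards [tendsto_inv₀_cobounded'.eventually hinf.eventually_analyticAt,
      tendsto_inv₀_cobounded'.eventually self_mem_nhdsWithin] with u hu hu0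
    have hu0' : u ≠ 0 := fun h => hu0 (by simp [h])
    have h1 := AnalyticAt.fun_comp hu (analyticAt_inv hu0')
    refine h1.congr (Eventually.of_forall fun z => ?_)
    simp
  obtain ⟨r, -, hr⟩ := (Metric.hasBasis_cobounded_compl_closedBall (0 : ℂ)).eventually_iff.1 hana
  obtain ⟨p, hp0, hp⟩ := exists_polynomial_mul_order_nonneg hG (isCompact_closedBall (0 : ℂ) r)
  have hpan (z : ℂ) : AnalyticAt ℂ (fun u => p.eval u) z :=
    AnalyticOnNhd.eval_polynomial p z trivial
  set K : ℂ → ℂ := fun u => p.eval u * G u with hK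
  have hKm : MeromorphicOn K Set.univ := fun z _ => (hpan z).meromorphicAt.mul (hG z)
  have hKo (z : ℂ) : 0 ≤ meromorphicOrderAt K z := by
    by_cases hz : z ∈ Metric.closedBall (0 : ℂ) r
    · exact hp z hz
    · exact ((hpan z).mul (hr hz)).meromorphicOrderAt_nonneg
  -- `K` has only removable singularities but possibly wrong values there; its normal form `H` is
  -- entire.
  set H := toMeromorphicNFOn K Set.univ with hH
  have hHK (z : ℂ) : H =ᶠ[𝓝[≠] z] K := hKm.toMeromorphicNFOn_eq_self_on_nhdsNE (Set.mem_univ z)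
  have hHd : Differentiable ℂ H := fun z => by
    refine AnalyticAt.differentiableAt ?_
    rw [← (meromorphicNFOn_toMeromorphicNFOn K Set.univ
      (Set.mem_univ z)).meromorphicOrderAt_nonneg_iff_analyticAt, meromorphicOrderAt_congr (hHK z)]
    exact hKo z
  have hpinv : MeromorphicAt (fun w : ℂ => p.eval w⁻¹) 0 :=
    (MeromorphicAt.id 0).fun_inv.polynomial_eval p
  obtain ⟨n, hn⟩ : MeromorphicAt (fun w => K w⁻¹) 0 := hpinv.mul hinf
  -- The exponent `n` clears the pole of `K` at infinity, and this constant exceeds the norm of the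
  -- cleared function there, so it bounds that function nearby.
  set C : ℝ := ‖((0 : ℂ) - 0) ^ n • K (0 : ℂ)⁻¹‖ + 1
  have hC : ∀ᶠ u in Bornology.cobounded ℂ, ‖K u‖ ≤ C * ‖u‖ ^ n := by
    have h1 := hn.continuousAt.norm.eventually_le_const (lt_add_one _)
    filter_upwards [tendsto_inv₀_cobounded.eventually h1,
      tendsto_norm_cobounded_atTop.eventually_ge_atTop 1] with u hu hu1
    have hu0 : 0 < ‖u‖ := by linarith
    rw [sub_zero, inv_inv, norm_smul, norm_pow, norm_inv, inv_pow, inv_mul_eq_div,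
      div_le_iff₀ (by positivity)] at hu
    exact hu
  obtain ⟨r', -, hr'⟩ := (Metric.hasBasis_cobounded_compl_closedBall (0 : ℂ)).eventually_iff.1 hC
  -- `H` and `K` agree only on punctured neighbourhoods, so the bound passes to `H` by continuity.
  have hHC : ∀ᶠ u in Bornology.cobounded ℂ, ‖H u‖ ≤ C * ‖u‖ ^ n := by
    refine (Metric.hasBasis_cobounded_compl_closedBall (0 : ℂ)).eventually_iff.2
      ⟨r', trivial, fun u hu => ?_⟩
    have h1 : Tendsto (fun z => ‖H z‖) (𝓝[≠] u) (𝓝 ‖H u‖) :=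
      (hHd u).continuousAt.norm.tendsto.mono_left nhdsWithin_le_nhds
    have h2 : Tendsto (fun z : ℂ => C * ‖z‖ ^ n) (𝓝[≠] u) (𝓝 (C * ‖u‖ ^ n)) :=
      (Continuous.tendsto (by fun_prop) u).mono_left nhdsWithin_le_nhds
    refine le_of_tendsto_of_tendsto h1 h2 ?_
    filter_upwards [hHK u, mem_nhdsWithin_of_mem_nhds
      (Metric.isClosed_closedBall.isOpen_compl.mem_nhds hu)] with z hz hz'
    rw [hz]
    exact hr' hz'
  obtain ⟨P, hP⟩ := exists_polynomial_of_growth hHd hHC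
  set R : RatFunc ℂ := algebraMap _ _ P / algebraMap _ _ p with hR
  refine ⟨R, eventually_codiscrete_iff.2 fun z => ?_⟩
  have hroots {q : Polynomial ℂ} (hq : q ≠ 0) : ∀ᶠ u in 𝓝[≠] z, q.eval u ≠ 0 := by
    have := (q.rootSet_finite ℂ).compl_mem_codiscrete
    filter_upwards [eventually_codiscrete_iff.1 this z] with u hu h0
    exact hu ((Polynomial.mem_rootSet).2 ⟨hq, by simpa using h0⟩)
  filter_upwards [hHK z, hroots hp0, hroots R.denom_ne_zero] with u hu hu0 hden
  rw [hP, hK] at hu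
  have h1 : R * algebraMap _ _ p = algebraMap _ _ P :=
    div_mul_cancel₀ _ (RatFunc.algebraMap_ne_zero hp0)
  have h2 := congrArg (RatFunc.eval (RingHom.id ℂ) u) h1
  rw [RatFunc.eval_mul _ _ hden (by simp), RatFunc.eval_algebraMap, RatFunc.eval_algebraMap] at h2
  simp only [Algebra.algebraMap_self, RingHom.id_apply, Polynomial.eval₂_id] at h2
  rw [← mul_left_inj' hu0, h2, hu, mul_comm]

/-- Transports an identity in u valid off a discrete set to one in τ; it needs only that x is
continuous and takes no value on an accumulating set. -/
theorem tendsto_burnsideX_codiscrete : Tendsto burnsideX (codiscrete ℍ) (codiscrete ℂ) := by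
  intro S hS
  refine eventually_codiscrete_iff.2 fun τ => ?_
  have h1 : ContinuousAt burnsideX τ := (mdifferentiable_burnsideX τ).continuousAt
  have h2 : Tendsto burnsideX (𝓝[≠] τ) (𝓝[≠] (burnsideX τ)) :=
    tendsto_nhdsWithin_iff.2 ⟨h1.tendsto.mono_left nhdsWithin_le_nhds,
      eventually_codiscrete_iff.1 (eventually_codiscrete_burnsideX_ne _) τ⟩
  exact h2.eventually (eventually_codiscrete_iff.1 hS _)

/-! ### The trace from the curve to the sphere -/

/-- Dividing by `k x` moves the value at `x` to 1, where the principal power is analytic. The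
squaring identity holds for every `s`, even across the branch cut. -/
theorem exists_analyticAt_sq_eq {k : ℂ → ℂ} {x : ℂ} (hk : AnalyticAt ℂ k x) (h0 : k x ≠ 0) :
    ∃ ψ : ℂ → ℂ, AnalyticAt ℂ ψ x ∧ ψ x ≠ 0 ∧ ∀ s, ψ s ^ 2 = k s := by
  obtain ⟨c, hc⟩ := IsAlgClosed.exists_pow_nat_eq (k x) two_pos
  have hc0 : c ≠ 0 := by rintro rfl; exact h0 (by simpa using hc.symm)
  refine ⟨fun s => c * (k s / k x) ^ (1 / 2 : ℂ), ?_, ?_, fun s => ?_⟩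
  · refine analyticAt_const.mul ((hk.fun_div analyticAt_const h0).cpow analyticAt_const ?_)
    rw [div_self h0]
    exact Complex.one_mem_slitPlane
  · simp [h0, hc0]
  · rw [mul_pow, ← Complex.cpow_nat_mul, hc]
    simp [mul_div_cancel₀ _ h0]

/-- If `s ↦ G (s²)` is meromorphic at `0`, then so is `G`. -/
theorem meromorphicAt_of_comp_sq {G : ℂ → ℂ} (h : MeromorphicAt (fun s => G (s ^ 2)) 0) :
    MeromorphicAt G 0 := by
  obtain ⟨n, hn⟩ := h
  refine ⟨n, ?_⟩
  simp only [sub_zero] at hn ⊢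
  set K : ℂ → ℂ := fun u => u ^ n • G u with hK
  have hh : AnalyticAt ℂ (fun s => K (s ^ 2)) 0 := by
    refine ((analyticAt_id.pow n).smul hn).congr (Eventually.of_forall fun s => ?_)
    simp [hK]
    ring
  -- Square roots of small numbers are small, so local properties in s descend to local properties
  -- in u = s².
  have hsqrt {P : ℂ → Prop} (hP : ∀ᶠ s in 𝓝 (0 : ℂ), P s) :
      ∀ᶠ u in 𝓝 (0 : ℂ), ∃ s, s ^ 2 = u ∧ P s := by
    obtain ⟨δ, hδ, hP⟩ := Metric.eventually_nhds_iff.1 hP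
    filter_upwards [Metric.ball_mem_nhds (0 : ℂ) (pow_pos hδ 2)] with u hu
    obtain ⟨s, rfl⟩ := IsAlgClosed.exists_pow_nat_eq u two_pos
    refine ⟨s, rfl, hP ?_⟩
    rw [mem_ball_zero_iff, norm_pow] at hu
    rw [dist_zero_right]
    exact lt_of_pow_lt_pow_left₀ 2 hδ.le hu
  -- Away from 0 the squaring map is locally biholomorphic, so `K` is differentiable there;
  -- continuity at 0 then removes the singularity.
  refine Complex.analyticAt_of_differentiable_on_punctured_nhds_of_continuousAt ?_ ?_
  · filter_upwards [nhdsWithin_le_nhds (hsqrt hh.eventually_analyticAt), self_mem_nhdsWithin]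
      with u hu hu0
    obtain ⟨s, rfl, hs⟩ := hu
    have hs0 : s ≠ 0 := by rintro rfl; simp at hu0
    refine AnalyticAt.differentiableAt ?_
    refine (analyticAt_comp_iff_of_deriv_ne_zero (g := K) (f := fun s : ℂ => s ^ 2)
      (by fun_prop) ?_).1 hs
    simpa using hs0
  · refine Metric.continuousAt_iff'.2 fun ε hε => ?_
    have h1 := Metric.continuousAt_iff'.1 hh.continuousAt ε hε
    filter_upwards [hsqrt h1] with u hu
    obtain ⟨s, rfl, hs⟩ := hu
    simpa using hs

/-- The sum of the values of `F` at the two points of the curve over `u`. -/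
def traceOnCurve (F : ℂ × ℂ → ℂ) (u : ℂ) : ℂ :=
  F (u, (u ^ 5 - u) ^ (1 / 2 : ℂ)) + F (u, -(u ^ 5 - u) ^ (1 / 2 : ℂ))

/-- The other choice of square root only swaps the two summands, so the jumps of the principal
branch do not matter. -/
theorem traceOnCurve_eq (F : ℂ × ℂ → ℂ) {u v : ℂ} (h : v ^ 2 = u ^ 5 - u) :
    traceOnCurve F u = F (u, v) + F (u, -v) := by
  have hr : ((u ^ 5 - u) ^ (1 / 2 : ℂ)) ^ 2 = v ^ 2 := by
    rw [← Complex.cpow_nat_mul, h]; simp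
  rw [traceOnCurve]
  rcases sq_eq_sq_iff_eq_or_eq_neg.1 hr with h | h
  · rw [h]
  · rw [h, neg_neg, add_comm]

theorem meromorphicAt_traceOnCurve_comp {F : ℂ × ℂ → ℂ} (hF : IsMeromorphicOnCurve F)
    {u v : ℂ → ℂ} (hu : AnalyticAt ℂ u 0) (hv : AnalyticAt ℂ v 0)
    (h : ∀ᶠ s in 𝓝 (0 : ℂ), v s ^ 2 = u s ^ 5 - u s) (hd : deriv u 0 ≠ 0 ∨ deriv v 0 ≠ 0) :
    MeromorphicAt (fun s => traceOnCurve F (u s)) 0 := by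
  have h1 := hF.1 u v hu hv h hd
  have h2 := hF.1 u (fun s => -v s) hu hv.fun_neg (by simpa using h) (by
    rw [deriv.fun_neg]; simpa using hd)
  refine (h1.fun_add h2).congr (nhdsWithin_le_nhds ?_)
  filter_upwards [h] with s hs
  exact (traceOnCurve_eq F hs).symm

theorem meromorphicAt_traceOnCurve {F : ℂ × ℂ → ℂ} (hF : IsMeromorphicOnCurve F) (e : ℂ) :
    MeromorphicAt (traceOnCurve F) e := by
  by_cases he : e ^ 5 - e = 0
  · have hk0 : 5 * e ^ 4 - 1 ≠ 0 := by
      intro h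
      have h1 : e = 0 := by linear_combination (-5 / 4 : ℂ) * he + e / 4 * h
      simp [h1] at h
    obtain ⟨ψ, hψ, hψ0, hsq⟩ := exists_analyticAt_sq_eq (x := 0)
      (k := fun s : ℂ => (5 * e ^ 4 - 1) + 10 * e ^ 3 * s ^ 2 + 10 * e ^ 2 * s ^ 4 + 5 * e * s ^ 6
        + s ^ 8) (by fun_prop) (by simpa using hk0)
    have h1 := meromorphicAt_traceOnCurve_comp hF (u := fun s => s ^ 2 + e) (v := fun s => s * ψ s)
      (by fun_prop) (by fun_prop) (Eventually.of_forall fun s => by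
        simp only [mul_pow, hsq]
        linear_combination -he) (Or.inr (by
        rw [deriv_fun_mul differentiableAt_fun_id hψ.differentiableAt]
        simpa using hψ0))
    have h2 := meromorphicAt_of_comp_sq (G := fun t => traceOnCurve F (t + e)) h1
    simpa using meromorphicAt_fun_comp_add_const_iff_meromorphicAt.1 h2
  · obtain ⟨ψ, hψ, hψ0, hsq⟩ := exists_analyticAt_sq_eq (x := 0)
      (k := fun s : ℂ => (s + e) ^ 5 - (s + e)) (by fun_prop) (by simpa using he)
    have h1 := meromorphicAt_traceOnCurve_comp hF (u := fun s => s + e) (v := ψ)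
      (by fun_prop) hψ (Eventually.of_forall hsq) (Or.inl (by simp))
    simpa using meromorphicAt_fun_comp_add_const_iff_meromorphicAt.1 h1

/-- In the coordinate at infinity, s ↦ -s fixes u = s⁻² and negates v, so the trace is the sum of
the coordinate expression of `F` and its reflection, and depends on s² alone. -/
theorem meromorphicAt_traceOnCurve_inv {F : ℂ × ℂ → ℂ} (hF : IsMeromorphicOnCurve F) :
    MeromorphicAt (fun w => traceOnCurve F w⁻¹) 0 := by
  refine meromorphicAt_of_comp_sq ?_
  have h1 := hF.2
  have h2 := MeromorphicAt.comp_analyticAt (g := fun s : ℂ => -s) (x := 0)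
    (by simpa using h1) (by fun_prop)
  refine (h1.fun_add h2).congr ?_
  filter_upwards [self_mem_nhdsWithin] with s hs
  have hs0 : s ≠ 0 := hs
  have hv : (s⁻¹ ^ 5 * (1 - s ^ 8) ^ (1 / 2 : ℂ)) ^ 2 = (s⁻¹ ^ 2) ^ 5 - s⁻¹ ^ 2 := by
    rw [mul_pow, ← Complex.cpow_nat_mul]
    simp
    field_simp
  simp only [Function.comp_apply]
  rw [show (s ^ 2)⁻¹ = s⁻¹ ^ 2 by simp, traceOnCurve_eq F hv]
  simp [Even.neg_pow (by decide : Even 8), inv_neg, Odd.neg_pow (by decide : Odd 5)]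

theorem exists_ratFunc_traceOnCurve {F : ℂ × ℂ → ℂ} (hF : IsMeromorphicOnCurve F) :
    ∃ R : RatFunc ℂ, traceOnCurve F =ᶠ[codiscrete ℂ] fun u => R.eval (RingHom.id ℂ) u :=
  exists_ratFunc_of_meromorphic (meromorphicAt_traceOnCurve hF) (meromorphicAt_traceOnCurve_inv hF)

theorem IsMeromorphicOnCurve.mul {F G : ℂ × ℂ → ℂ} (hF : IsMeromorphicOnCurve F)
    (hG : IsMeromorphicOnCurve G) : IsMeromorphicOnCurve fun p => F p * G p :=
  ⟨fun u v hu hv h hd => (hF.1 u v hu hv h hd).fun_mul (hG.1 u v hu hv h hd),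
    hF.2.fun_mul hG.2⟩

theorem IsMeromorphicOnCurve.add {F G : ℂ × ℂ → ℂ} (hF : IsMeromorphicOnCurve F)
    (hG : IsMeromorphicOnCurve G) : IsMeromorphicOnCurve fun p => F p + G p :=
  ⟨fun u v hu hv h hd => (hF.1 u v hu hv h hd).fun_add (hG.1 u v hu hv h hd),
    hF.2.fun_add hG.2⟩

theorem IsMeromorphicOnCurve.inv {F : ℂ × ℂ → ℂ} (hF : IsMeromorphicOnCurve F) :
    IsMeromorphicOnCurve fun p => (F p)⁻¹ :=
  ⟨fun u v hu hv h hd => (hF.1 u v hu hv h hd).fun_inv, hF.2.fun_inv⟩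

theorem isMeromorphicOnCurve_ratFunc (R : RatFunc ℂ) :
    IsMeromorphicOnCurve fun p => R.eval (RingHom.id ℂ) p.1 :=
  ⟨fun _ _ hu _ _ _ => hu.meromorphicAt.ratFunc_eval R,
    ((MeromorphicAt.id 0).fun_inv.fun_pow 2).ratFunc_eval R⟩

theorem isMeromorphicOnCurve_snd : IsMeromorphicOnCurve fun p => p.2 := by
  refine ⟨fun _ _ _ hv _ _ => hv.meromorphicAt, ?_⟩
  refine ((MeromorphicAt.id 0).fun_inv.fun_pow 5).fun_mul (AnalyticAt.meromorphicAt ?_)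
  refine AnalyticAt.cpow (by fun_prop) analyticAt_const ?_
  simp [Complex.one_mem_slitPlane]

/-- The nontrivial direction is F = ½(Tr F + v Tr(F/v)): the two traces pick out the even and odd
parts of F under v ↦ -v, and both are rational in u. -/
theorem mem_functionSubring_iff {g : FunctionGerms} :
    g ∈ functionSubring ↔ ∃ F, IsMeromorphicOnCurve F ∧
      g = toGerm (fun τ => F (burnsideX τ, burnsideY τ)) := by
  constructor
  · rintro ⟨R₁, R₂, rfl⟩
    exact ⟨_, (isMeromorphicOnCurve_ratFunc R₁).add
      (isMeromorphicOnCurve_snd.mul (isMeromorphicOnCurve_ratFunc R₂)), rfl⟩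
  · rintro ⟨F, hF, rfl⟩
    obtain ⟨R₁, h1⟩ := exists_ratFunc_traceOnCurve hF
    obtain ⟨R₂, h2⟩ := exists_ratFunc_traceOnCurve (hF.mul isMeromorphicOnCurve_snd.inv)
    refine ⟨RatFunc.C (1 / 2) * R₁, RatFunc.C (1 / 2) * R₂, ?_⟩
    rw [map_mul, map_mul, evalGerm_C]
    refine toGerm_eq_iff.2 ?_
    filter_upwards [tendsto_burnsideX_codiscrete.eventually h1,
      tendsto_burnsideX_codiscrete.eventually h2] with τ h1 h2
    have hy := burnsideY_ne_zero τ
    rw [traceOnCurve_eq _ (burnsideY_sq τ)] at h1 h2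
    simp only [← h1, ← h2]
    field_simp
    ring

end

theorem proposition5 :
    -- the functions are holomorphic in the upper half-plane and parametrize the curve
    (MDifferentiable 𝓘(ℂ) 𝓘(ℂ) burnsideX ∧ MDifferentiable 𝓘(ℂ) 𝓘(ℂ) burnsideY ∧
      ∀ τ, burnsideY τ ^ 2 = burnsideX τ ^ 5 - burnsideX τ) ∧
    -- the pole `τ = 2`
    (VanishesAtReal (cuspParam 2 (-5) 1 (-2)) 2 ∧ ∃ A B : ℕ → ℤ,
      BeginsWith A [1, 2, -1, -2, 3, 2, -4, -4] ∧
      BeginsWith B [1, -3, -3, 14, 6, -33, -20] ∧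
      HasCuspExpansion burnsideX (cuspParam 2 (-5) 1 (-2)) (1 / 2) (-2) 8 A ∧
      HasCuspExpansion burnsideY (cuspParam 2 (-5) 1 (-2)) ((√2 : ℝ) / 8) (-5) 8 B) ∧
    -- the zero `τ = 0`
    (VanishesAtReal (cuspParam 1 (-2) 2 0) 0 ∧ ∃ A B : ℕ → ℤ,
      BeginsWith A [1, 2, 5, 10, 18, 32] ∧
      BeginsWith B [1, 9, 42, 147, 444, 1206] ∧
      HasCuspExpansion burnsideX (cuspParam 1 (-2) 2 0)
        (2 * Complex.exp (3 / 4 * Real.pi * Complex.I)) 2 8 A ∧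
      HasCuspExpansion burnsideY (cuspParam 1 (-2) 2 0)
        (-Complex.exp (-(1 / 8) * Real.pi * Complex.I) * (√2 : ℝ)) 1 8 B) ∧
    -- the pre-images `1/2`, `i∞`, `1`, `-1` of `1`, `-1`, `i`, `-i`
    (VanishesAtReal (cuspParam 3 (-2) 2 (-1)) (1 / 2) ∧
      VanishesAtInfty (cuspParam 1 (-2) 0 1) ∧
      VanishesAtReal (cuspParam 1 (-2) 1 (-1)) 1 ∧
      VanishesAtReal (cuspParam (-1) (-2) 1 1) (-1) ∧ ∃ A B : ℕ → ℤ,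
      BeginsWith A [1, 4, 8, 16, 32, 56, 96] ∧
      BeginsWith B [1, 6, 24, 80, 231, 606] ∧
      HasCuspExpansion burnsideX (cuspParam 3 (-2) 2 (-1)) 1 0 2 A ∧
      HasCuspExpansion burnsideY (cuspParam 3 (-2) 2 (-1)) 4 1 2 B ∧
      HasCuspExpansion burnsideX (cuspParam 1 (-2) 0 1) (-1) 0 2 A ∧
      HasCuspExpansion burnsideY (cuspParam 1 (-2) 0 1) (-4 * Complex.I) 1 2 B ∧
      HasCuspExpansion burnsideX (cuspParam 1 (-2) 1 (-1)) Complex.I 0 2 A ∧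
      HasCuspExpansion burnsideY (cuspParam 1 (-2) 1 (-1))
        (4 * Complex.exp (Real.pi * Complex.I / 4)) 1 2 B ∧
      HasCuspExpansion burnsideX (cuspParam (-1) (-2) 1 1) (-Complex.I) 0 2 A ∧
      HasCuspExpansion burnsideY (cuspParam (-1) (-2) 1 1)
        (4 * Complex.exp (-(Real.pi * Complex.I / 4))) 1 2 B) ∧
    -- the functions of `τ` that come from meromorphic functions on the curve form the field
    -- generated by `x(τ)` and `y(τ)` over the constants, and are exactly the functions
    -- `R₁(x(τ)) + y(τ) R₂(x(τ))`, each in one way only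
    ∃ K : Subring FunctionGerms,
      IsField K ∧
      (∀ g, g ∈ K ↔ ∃ F, IsMeromorphicOnCurve F ∧
        g = toGerm (fun τ => F (burnsideX τ, burnsideY τ))) ∧
      (∀ R₁ R₂ : RatFunc ℂ, toGerm (rationalInXY R₁ R₂) ∈ K) ∧
      (∀ g ∈ K, ∃! R : RatFunc ℂ × RatFunc ℂ, g = toGerm (rationalInXY R.1 R.2)) ∧
      (∀ L : Subring FunctionGerms, IsField L → (∀ c : ℂ, toGerm (fun _ => c) ∈ L) →
        toGerm burnsideX ∈ L → toGerm burnsideY ∈ L → K ≤ L) := by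
  exact ⟨⟨mdifferentiable_burnsideX, mdifferentiable_burnsideY, burnsideY_sq⟩, pole_expansions,
    zero_expansions, branch_expansions, functionSubring, isField_functionSubring,
    fun _ => mem_functionSubring_iff, fun R₁ R₂ => ⟨R₁, R₂, rfl⟩,
    fun _ hg => existsUnique_rationalInXY hg, fun _ hL => functionSubring_le hL⟩
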